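/- Let $\mathfrak g$ be a finite-dimensional simple complex Lie algebra with Cartan–Killing form $\kappa$. *The family.* For $e_1,e_2\in\mathbb C$ put $e_3=-(e_1+e_2)$, and let $V_{(e_1,e_2)}$ be the algebra of functions on the cubic $Y^2=4(X-e_1)(X-e_2)(X-e_3)$ with basis $A_{2k}=(X-e_1)^k$, $A_{2k+1}=\tfrac12Y(X-e_1)^{k-1}$ $(k\in\mathbb Z)$. Thus $$A_nA_m=\begin{cases}A_{n+m}, & n \text{ or } m \text{ even},\\ A_{n+m}+3e_1A_{n+m-2}+(e_1-e_2)(2e_1+e_2)A_{n+m-4}, & n,m\text{ odd}.\end{cases}$$ The current algebra $\overline{\mathcal G}_{(e_1,e_2)}=\mathfrak g\otimes V_{(e_1,e_2)}$ has the bracket $[x\otimes A_n,y\otimes A_m]=[x,y]\otimes A_nA_m$, and $\mathfrak g\otimes A_n$ is its part of degree $n$. Taking $e_1,e_2$ to be indeterminates, the family of all these algebras is a Lie algebra $\overline{\mathcal G}$ over $S=\mathbb C[e_1,e_2]$; the single algebras are Lie algebras over $S=\mathbb C$. *Almost-graded central extensions.* Let $L$ be one of these Lie algebras over $S$, with homogeneous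 parts $L_n$. A central extension of $L$ is an exact sequence $0\to S\,t\to E\to L\to0$ of Lie algebras over $S$ with $St\cong S$ central in $E$. It is almost-graded if there is a decomposition $E=\bigoplus_{n\in\mathbb Z}E_n$ into finitely generated $S$-submodules such that $E_n$ is mapped onto $L_n$ for every $n$, the element $t$ is homogeneous, and for some constants $R_1,R_2\in\mathbb Z$ one has $[E_n,E_m]\subseteq\bigoplus_{h=n+m+R_1}^{n+m+R_2}E_h$ for all $n,m$. Two central extensions are equivalent if there is an isomorphism of Lie algebras over $S$ between them which induces the identity on $St$ and on $L$. *The geometric extensions.* For $p\in S$ let $\widehat{\mathcal G}^{\,p}$ be the central extension with bracket $$[x\otimes A_n,y\otimes A_m]=[x,y]\otimes A_nA_m+p\,\kappa(x,y)\,\gamma_{n,m}\,t,$$ $$\gamma_{n,m}=\begin{cases}-n\,\delta_m^{-n}, & n,m\text{ even},\\ 0, & n,m\text{ of different parity},\\ -n\,\delta_m^{-n}+3e_1(-n+1)\,\delta_m^{-n+2}+(e_1-e_2)(2e_1+e_2)(-n+2)\,\delta_m^{-n+4}, & n,m\text{ odd}.\end{cases}$$ Then: 1. Every symmetric invariant bilinear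 form $\beta$ on $\mathfrak g$ is a scalar multiple $c\,\kappa$ of the Cartan–Killing form, with a unique $c\in\mathbb C$. 2. For all $e_1,e_2\in\mathbb C$ and $n,m\in\mathbb Z$ one has $\gamma_{n,m}=\frac1{2\pi\mathrm i}\int_{C}A_n\,dA_m$, where $C$ is a cycle separating the point $(e_1,0)$ from $\infty$, namely any sufficiently small circle around $\infty$ with respect to the local coordinate $z=(X-e_1)^{-1/2}$ (chosen so that $Y\sim 2z^{-3}$), with reversed orientation. 3. (Family.) For every polynomial $p\in\mathbb C[e_1,e_2]$ the central extension $\widehat{\mathcal G}^{\,p}$ of the family $\overline{\mathcal G}$ over $\mathbb C[e_1,e_2]$ is almost-graded, and every almost-graded central extension of $\overline{\mathcal G}$ over $\mathbb C[e_1,e_2]$ is equivalent to $\widehat{\mathcal G}^{\,p}$ for a unique polynomial $p\in\mathbb C[e_1,e_2]$. 4. (Single algebras.) For all $e_1,e_2\in\mathbb C$ and every $c\in\mathbb C$ the central extension $\widehat{\mathcal G}^{\,c}$ of $\overline{\mathcal G}_{(e_1,e_2)}$ is almost-graded, and every almost-graded central extension of $\overline{\mathcal G}_{(e_1,e_2)}$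 over $\mathbb C$ is equivalent to $\widehat{\mathcal G}^{\,c}$ for a unique $c\in\mathbb C$. -/

import Mathlib

universe u v

open scoped TensorProduct LaurentPolynomial

noncomputable section

namespace EllipticCurrent

/-! ### The family of function algebras -/

section FunctionAlgebra

section Basis

variable {S : Type*} [CommRing S] (q : S[T;T⁻¹])

/-- The `S`-basis of `S[T, T⁻¹][ω] / (ω² - q)` that consists of the elements `T ^ k` (at the index
`2 k`) and `ω T ^ k` (at the index `2 k + 1`). -/
def quadraticBasis : Module.Basis ℤ S (QuadraticAlgebra S[T;T⁻¹] q 0) :=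
  ((AddMonoidAlgebra.basis ℤ S).smulTower (QuadraticAlgebra.basis q 0)).reindex
    (Int.divModEquiv 2).symm

lemma basis_zero_one : QuadraticAlgebra.basis q 0 0 = ⟨1, 0⟩ ∧
    QuadraticAlgebra.basis q 0 1 = ⟨0, 1⟩ := by
  constructor <;> (apply (QuadraticAlgebra.basis q 0).repr.injective; ext i; fin_cases i <;> simp)

lemma quadraticBasis_even (k : ℤ) :
    quadraticBasis q (2 * k) = ⟨LaurentPolynomial.T k, 0⟩ := by
  have h : (Int.divModEquiv 2) (2 * k) = (k, 0) := by
    rw [← Equiv.eq_symm_apply, Int.divModEquiv_symm_apply]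
    simp [mul_comm]
  rw [quadraticBasis, Module.Basis.reindex_apply, Equiv.symm_symm, h, Module.Basis.smulTower_apply,
    (basis_zero_one q).1]
  ext1
  · simp [AddMonoidAlgebra.basis]
  · simp [AddMonoidAlgebra.basis]

lemma quadraticBasis_odd (k : ℤ) :
    quadraticBasis q (2 * k + 1) = ⟨0, LaurentPolynomial.T k⟩ := by
  have h : (Int.divModEquiv 2) (2 * k + 1) = (k, 1) := by
    rw [← Equiv.eq_symm_apply, Int.divModEquiv_symm_apply]
    simp [mul_comm]
  rw [quadraticBasis, Module.Basis.reindex_apply, Equiv.symm_symm, h, Module.Basis.smulTower_apply,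
    (basis_zero_one q).2]
  ext1
  · simp [AddMonoidAlgebra.basis]
  · simp [AddMonoidAlgebra.basis]

end Basis

variable (S : Type*) [CommRing S] (e₁ e₂ : S)

/-- The algebra of functions on the cubic `Y² = 4 (X - e₁) (X - e₂) (X - e₃)`, `e₃ = -(e₁ + e₂)`,
which are regular outside `∞` and `(e₁, 0)`. With `T = X - e₁` and `ω = Y / (2 (X - e₁))` it is
generated over the Laurent polynomials in `T` by `ω`, subject to
`ω² = T + 3 e₁ + (e₁ - e₂) (2 e₁ + e₂) T⁻¹`. The base ring `S` is `ℂ` for a single algebra, and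
`ℂ[e₁, e₂]` for the whole family. -/
def FunctionAlgebra : Type _ :=
  QuadraticAlgebra S[T;T⁻¹]
    (LaurentPolynomial.T 1 + LaurentPolynomial.C (3 * e₁) +
      LaurentPolynomial.C ((e₁ - e₂) * (2 * e₁ + e₂)) * LaurentPolynomial.T (-1)) 0

instance : CommRing (FunctionAlgebra S e₁ e₂) := QuadraticAlgebra.instCommRing

instance (R : Type*) [CommRing R] [Algebra R S] : Algebra R (FunctionAlgebra S e₁ e₂) :=
  inferInstanceAs (Algebra R (QuadraticAlgebra S[T;T⁻¹] _ _))

instance (R : Type*) [CommRing R] [Algebra R S] :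
    IsScalarTower R S (FunctionAlgebra S e₁ e₂) :=
  inferInstanceAs (IsScalarTower R S (QuadraticAlgebra S[T;T⁻¹] _ _))

/-- The homogeneous basis: `A (2k) = (X - e₁) ^ k = T ^ k` and
`A (2k+1) = (1/2) Y (X - e₁) ^ (k-1) = ω T ^ k`. -/
def A : Module.Basis ℤ S (FunctionAlgebra S e₁ e₂) :=
  quadraticBasis (LaurentPolynomial.T 1 + LaurentPolynomial.C (3 * e₁) +
    LaurentPolynomial.C ((e₁ - e₂) * (2 * e₁ + e₂)) * LaurentPolynomial.T (-1))

/-- The function `a + b ω`. -/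
def FunctionAlgebra.mk (a b : S[T;T⁻¹]) : FunctionAlgebra S e₁ e₂ := QuadraticAlgebra.mk a b

variable {S e₁ e₂}

lemma A_even (k : ℤ) : A S e₁ e₂ (2 * k) = .mk S e₁ e₂ (LaurentPolynomial.T k) 0 :=
  quadraticBasis_even _ k

lemma A_odd (k : ℤ) : A S e₁ e₂ (2 * k + 1) = .mk S e₁ e₂ 0 (LaurentPolynomial.T k) :=
  quadraticBasis_odd _ k

/-- The structure constants of the function algebra. -/
theorem A_mul_A (n m : ℤ) :
    A S e₁ e₂ n * A S e₁ e₂ m =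
      if Odd n ∧ Odd m then
        A S e₁ e₂ (n + m) + (3 * e₁) • A S e₁ e₂ (n + m - 2)
          + ((e₁ - e₂) * (2 * e₁ + e₂)) • A S e₁ e₂ (n + m - 4)
      else A S e₁ e₂ (n + m) := by
  have hmul (a b c d : S[T;T⁻¹]) :
      FunctionAlgebra.mk S e₁ e₂ a b * FunctionAlgebra.mk S e₁ e₂ c d =
        FunctionAlgebra.mk S e₁ e₂ (a * c + (LaurentPolynomial.T 1 + LaurentPolynomial.C (3 * e₁) +
          LaurentPolynomial.C ((e₁ - e₂) * (2 * e₁ + e₂)) * LaurentPolynomial.T (-1)) * b * d)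
          (a * d + b * c + 0 * b * d) := rfl
  have hadd (a b c d : S[T;T⁻¹]) :
      FunctionAlgebra.mk S e₁ e₂ a b + FunctionAlgebra.mk S e₁ e₂ c d =
        FunctionAlgebra.mk S e₁ e₂ (a + c) (b + d) := rfl
  have hsmul (s : S) (a b : S[T;T⁻¹]) :
      s • FunctionAlgebra.mk S e₁ e₂ a b =
        FunctionAlgebra.mk S e₁ e₂ (s • a) (s • b) := rfl
  obtain ⟨i, rfl | rfl⟩ := Int.even_or_odd' n <;> obtain ⟨j, rfl | rfl⟩ := Int.even_or_odd' m
  · rw [if_neg (by simp), show 2 * i + 2 * j = 2 * (i + j) by ring, A_even, A_even, A_even, hmul]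
    congr 1 <;> (try simp only [LaurentPolynomial.T_add]) <;> ring1
  · rw [if_neg (by simp), show 2 * i + (2 * j + 1) = 2 * (i + j) + 1 by ring, A_even, A_odd, A_odd,
      hmul]
    congr 1 <;> (try simp only [LaurentPolynomial.T_add]) <;> ring1
  · rw [if_neg (by simp), show 2 * i + 1 + 2 * j = 2 * (i + j) + 1 by ring, A_even, A_odd, A_odd,
      hmul]
    congr 1 <;> (try simp only [LaurentPolynomial.T_add]) <;> ring1
  · rw [if_pos (by simp), show 2 * i + 1 + (2 * j + 1) = 2 * (i + j + 1) by ring,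
      show 2 * (i + j + 1) - 2 = 2 * (i + j) by ring,
      show 2 * (i + j + 1) - 4 = 2 * (i + j + (-1)) by ring, A_odd, A_odd, A_even, A_even, A_even,
      hmul, hsmul, hsmul, hadd, hadd]
    congr 1 <;> simp only [LaurentPolynomial.T_add, LaurentPolynomial.smul_eq_C_mul] <;> ring1

end FunctionAlgebra

/-! ### The cocycle of the function algebra -/

section Cocycle

variable {S : Type*} [CommRing S] (e₁ e₂ : S)

/-- The value of `(2πi)⁻¹ ∫ A_n dA_m` along a cycle separating `(e₁, 0)` from `∞`. -/
def cycleValue (n m : ℤ) : S :=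
  if Even n ∧ Even m then
    if m = -n then -(n : S) else 0
  else if Odd n ∧ Odd m then
    (if m = -n then -(n : S) else 0)
      + (if m = -n + 2 then 3 * e₁ * (-(n : S) + 1) else 0)
      + (if m = -n + 4 then (e₁ - e₂) * (2 * e₁ + e₂) * (-(n : S) + 2) else 0)
  else 0

/-- The `S`-bilinear form `(f, g) ↦ (2πi)⁻¹ ∫ f dg` on the function algebra. -/
def cycleForm : LinearMap.BilinForm S (FunctionAlgebra S e₁ e₂) :=
  (A S e₁ e₂).constr S fun n => (A S e₁ e₂).constr S fun m => cycleValue e₁ e₂ n m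

lemma cycleForm_A (n m : ℤ) :
    cycleForm e₁ e₂ (A S e₁ e₂ n) (A S e₁ e₂ m) = cycleValue e₁ e₂ n m := by
  simp [cycleForm, Module.Basis.constr_basis]

lemma cycleValue_skew (n m : ℤ) : (cycleValue e₁ e₂ n m : S) = -cycleValue e₁ e₂ m n := by
  unfold cycleValue
  by_cases h0 : m = -n
  · subst h0
    split_ifs <;> first | omega | (push_cast; ring1) | grind
  by_cases h2 : m = -n + 2
  · subst h2
    split_ifs <;> first | omega | (push_cast; ring1) | grind
  by_cases h4 : m = -n + 4
  · subst h4
    split_ifs <;> first | omega | (push_cast; ring1) | grind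
  split_ifs <;> first | omega | simp

variable {e₁ e₂} in
lemma A_induction {P : FunctionAlgebra S e₁ e₂ → Prop} (hA : ∀ n, P (A S e₁ e₂ n))
    (hadd : ∀ f g, P f → P g → P (f + g)) (hsmul : ∀ (c : S) f, P f → P (c • f))
    (f : FunctionAlgebra S e₁ e₂) : P f := by
  have hf := (A S e₁ e₂).mem_span f
  induction hf using Submodule.span_induction with
  | mem x hx => obtain ⟨n, rfl⟩ := hx; exact hA n
  | zero => simpa using hsmul 0 _ (hA 0)
  | add x y _ _ hx hy => exact hadd x y hx hy
  | smul c x _ hx => exact hsmul c x hx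

lemma cycleForm_skew (f g : FunctionAlgebra S e₁ e₂) :
    cycleForm e₁ e₂ f g = -cycleForm e₁ e₂ g f := by
  induction f using A_induction with
  | hA n =>
    induction g using A_induction with
    | hA m => rw [cycleForm_A, cycleForm_A, cycleValue_skew]
    | hadd g g' h h' => simp only [map_add, LinearMap.add_apply, h, h']; ring
    | hsmul c g h => simp only [map_smul, LinearMap.smul_apply, h, smul_neg]
  | hadd f f' h h' => simp only [map_add, LinearMap.add_apply, h, h']; ring
  | hsmul c f h => simp only [map_smul, LinearMap.smul_apply, h, smul_neg]

lemma cycleValue_even_even (i j : ℤ) :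
    (cycleValue e₁ e₂ (2 * i) (2 * j) : S) = if i + j = 0 then -(2 * i : S) else 0 := by
  have h : 2 * j = -(2 * i) ↔ i + j = 0 := by omega
  simp [cycleValue, h]

lemma cycleValue_odd_odd (i j : ℤ) :
    (cycleValue e₁ e₂ (2 * i + 1) (2 * j + 1) : S) =
      (if i + j = -1 then -(2 * i + 1 : S) else 0) + (if i + j = 0 then 3 * e₁ * (-(2 * i)) else 0)
        + (if i + j = 1 then (e₁ - e₂) * (2 * e₁ + e₂) * (-(2 * i) + 1) else 0) := by
  have h : 2 * j + 1 = -(2 * i + 1) ↔ i + j = -1 := by omega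
  have h' : 2 * j + 1 = -(2 * i + 1) + 2 ↔ i + j = 0 := by omega
  have h'' : 2 * j + 1 = -(2 * i + 1) + 4 ↔ i + j = 1 := by omega
  rw [cycleValue, if_neg (by simp), if_pos (by simp)]
  simp only [h, h', h'']
  push_cast
  congr 2
  · congr 1; ring
  · congr 1; ring

lemma cycleValue_even_odd (i j : ℤ) : (cycleValue e₁ e₂ (2 * i) (2 * j + 1) : S) = 0 := by
  rw [cycleValue, if_neg (by simp), if_neg (by simp)]

lemma cycleValue_odd_even (i j : ℤ) : (cycleValue e₁ e₂ (2 * i + 1) (2 * j) : S) = 0 := by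
  rw [cycleValue, if_neg (by simp), if_neg (by simp)]

variable {e₁ e₂} in
lemma A_even_mul_even (i j : ℤ) :
    A S e₁ e₂ (2 * i) * A S e₁ e₂ (2 * j) = A S e₁ e₂ (2 * (i + j)) := by
  rw [A_mul_A, if_neg (by simp), mul_add]

variable {e₁ e₂} in
lemma A_even_mul_odd (i j : ℤ) :
    A S e₁ e₂ (2 * i) * A S e₁ e₂ (2 * j + 1) = A S e₁ e₂ (2 * (i + j) + 1) := by
  rw [A_mul_A, if_neg (by simp), mul_add, add_assoc]

variable {e₁ e₂} in
lemma A_odd_mul_odd (i j : ℤ) :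
    A S e₁ e₂ (2 * i + 1) * A S e₁ e₂ (2 * j + 1) =
      A S e₁ e₂ (2 * (i + j + 1)) + (3 * e₁) • A S e₁ e₂ (2 * (i + j))
        + ((e₁ - e₂) * (2 * e₁ + e₂)) • A S e₁ e₂ (2 * (i + j - 1)) := by
  rw [A_mul_A, if_pos (by simp)]
  congr 3 <;> ring_nf

lemma cycleForm_mul_basis (n m k : ℤ) :
    cycleForm e₁ e₂ (A S e₁ e₂ n * A S e₁ e₂ m) (A S e₁ e₂ k)
      + cycleForm e₁ e₂ (A S e₁ e₂ m * A S e₁ e₂ k) (A S e₁ e₂ n)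
      + cycleForm e₁ e₂ (A S e₁ e₂ k * A S e₁ e₂ n) (A S e₁ e₂ m) = 0 := by
  have eoo (i j l : ℤ) :
      cycleForm e₁ e₂ (A S e₁ e₂ (2 * i) * A S e₁ e₂ (2 * j + 1)) (A S e₁ e₂ (2 * l + 1))
      + cycleForm e₁ e₂ (A S e₁ e₂ (2 * j + 1) * A S e₁ e₂ (2 * l + 1)) (A S e₁ e₂ (2 * i))
      + cycleForm e₁ e₂ (A S e₁ e₂ (2 * l + 1) * A S e₁ e₂ (2 * i)) (A S e₁ e₂ (2 * j + 1)) = 0 := by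
    rw [mul_comm _ (A S e₁ e₂ (2 * i)), A_even_mul_odd, A_odd_mul_odd, A_even_mul_odd]
    simp only [map_add, map_smul, LinearMap.add_apply, LinearMap.smul_apply, cycleForm_A,
      cycleValue_even_even, cycleValue_odd_odd, smul_eq_mul]
    by_cases h1 : i + j + l = -1
    · obtain rfl : l = -i - j - 1 := by omega
      simp (disch := omega) only [if_pos, if_neg]
      push_cast
      ring1
    by_cases h0 : i + j + l = 0
    · obtain rfl : l = -i - j := by omega
      simp (disch := omega) only [if_pos, if_neg]
      push_cast
      ring1
    by_cases h2 : i + j + l = 1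
    · obtain rfl : l = -i - j + 1 := by omega
      simp (disch := omega) only [if_pos, if_neg]
      push_cast
      ring1
    simp (disch := omega) only [if_neg]
    ring1
  obtain ⟨i, rfl | rfl⟩ := Int.even_or_odd' n <;> obtain ⟨j, rfl | rfl⟩ := Int.even_or_odd' m <;>
    obtain ⟨l, rfl | rfl⟩ := Int.even_or_odd' k
  · simp only [A_even_mul_even, cycleForm_A, cycleValue_even_even]
    by_cases h : i + j + l = 0
    · obtain rfl : l = -i - j := by omega
      split_ifs <;> first | omega | (push_cast; ring1)
    · split_ifs <;> first | omega | ring1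
  · rw [mul_comm (A S e₁ e₂ (2 * l + 1)), A_even_mul_even, A_even_mul_odd, A_even_mul_odd]
    simp only [cycleForm_A, cycleValue_even_odd, cycleValue_odd_even, add_zero]
  · rw [mul_comm (A S e₁ e₂ (2 * j + 1)), A_even_mul_even, A_even_mul_odd, A_even_mul_odd]
    simp only [cycleForm_A, cycleValue_even_odd, cycleValue_odd_even, add_zero]
  · exact eoo i j l
  · rw [mul_comm (A S e₁ e₂ (2 * i + 1)), A_even_mul_even, A_even_mul_odd, A_even_mul_odd]
    simp only [cycleForm_A, cycleValue_even_odd, cycleValue_odd_even, add_zero]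
  · linear_combination eoo j l i
  · linear_combination eoo l i j
  · rw [A_odd_mul_odd, A_odd_mul_odd, A_odd_mul_odd]
    simp only [map_add, map_smul, LinearMap.add_apply, LinearMap.smul_apply, cycleForm_A,
      cycleValue_even_odd, smul_zero, add_zero]

lemma cycleForm_mul (f g h : FunctionAlgebra S e₁ e₂) :
    cycleForm e₁ e₂ (f * g) h + cycleForm e₁ e₂ (g * h) f + cycleForm e₁ e₂ (h * f) g = 0 := by
  induction f using A_induction with
  | hA n =>
    induction g using A_induction with
    | hA m =>
      induction h using A_induction with
      | hA k =>
        exact cycleForm_mul_basis e₁ e₂ n m k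
      | hadd f f' h h' =>
        simp only [mul_add, add_mul, map_add, LinearMap.add_apply]
        linear_combination h + h'
      | hsmul c f h =>
        simp only [mul_smul_comm, smul_mul_assoc, map_smul, LinearMap.smul_apply, smul_eq_mul]
        linear_combination c * h
    | hadd f f' h h' =>
      simp only [mul_add, add_mul, map_add, LinearMap.add_apply]
      linear_combination h + h'
    | hsmul c f h =>
      simp only [mul_smul_comm, smul_mul_assoc, map_smul, LinearMap.smul_apply, smul_eq_mul]
      linear_combination c * h
  | hadd f f' h h' =>
    simp only [mul_add, add_mul, map_add, LinearMap.add_apply]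
    linear_combination h + h'
  | hsmul c f h =>
    simp only [mul_smul_comm, smul_mul_assoc, map_smul, LinearMap.smul_apply, smul_eq_mul]
    linear_combination c * h

end Cocycle

/-! ### Current algebras -/

section CurrentAlgebra

variable (S : Type*) [CommRing S] [Algebra ℂ S] (e₁ e₂ : S)
variable (g : Type*) [LieRing g] [LieAlgebra ℂ g]

/-- The current algebra `g ⊗ FunctionAlgebra` with Lie bracket `⁅f ⊗ x, h ⊗ y⁆ = f h ⊗ ⁅x, y⁆`, as a
Lie algebra over `S`. -/
def CurrentAlgebra : Type _ := FunctionAlgebra S e₁ e₂ ⊗[ℂ] g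

instance : LieRing (CurrentAlgebra S e₁ e₂ g) :=
  LieAlgebra.ExtendScalars.instLieRing ℂ (FunctionAlgebra S e₁ e₂) g

instance : LieAlgebra S (CurrentAlgebra S e₁ e₂ g) where
  toModule := inferInstanceAs (Module S (FunctionAlgebra S e₁ e₂ ⊗[ℂ] g))
  lie_smul s x y := by
    have h (u : FunctionAlgebra S e₁ e₂ ⊗[ℂ] g) :
        s • u = algebraMap S (FunctionAlgebra S e₁ e₂) s • u := (algebraMap_smul _ s u).symm
    exact (congrArg (fun u : FunctionAlgebra S e₁ e₂ ⊗[ℂ] g => ⁅(show _ ⊗[ℂ] _ from x), u⁆)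
      (h y)).trans ((lie_smul (R := FunctionAlgebra S e₁ e₂)
        (L := FunctionAlgebra S e₁ e₂ ⊗[ℂ] g) _ _ _).trans (h _).symm)

variable {S e₁ e₂ g} in
/-- The element `f ⊗ x` of the current algebra. -/
def CurrentAlgebra.tmul (f : FunctionAlgebra S e₁ e₂) (x : g) : CurrentAlgebra S e₁ e₂ g := f ⊗ₜ x

variable {S e₁ e₂ g} in
lemma CurrentAlgebra.lie_tmul (f h : FunctionAlgebra S e₁ e₂) (x y : g) :
    ⁅tmul f x, tmul h y⁆ = tmul (f * h) ⁅x, y⁆ := rfl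

variable {S e₁ e₂ g} in
lemma CurrentAlgebra.induction {P : CurrentAlgebra S e₁ e₂ g → Prop}
    (h : ∀ f x, P (tmul f x)) (hadd : ∀ u v, P u → P v → P (u + v))
    (u : CurrentAlgebra S e₁ e₂ g) : P u :=
  TensorProduct.induction_on u
    (by simpa [tmul] using (h 0 0 : P ((0 : FunctionAlgebra S e₁ e₂) ⊗ₜ[ℂ] (0 : g)))) h hadd

/-- The homogeneous elements `A n ⊗ x` of degree `n`. -/
def homogeneousPart (n : ℤ) : Submodule S (CurrentAlgebra S e₁ e₂ g) :=
  Submodule.span S (Set.range fun x : g => CurrentAlgebra.tmul (A S e₁ e₂ n) x)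

end CurrentAlgebra

/-! ### Almost-graded central extensions -/

section Extension

variable (S : Type*) [CommRing S]

/-- A family `gr` of submodules is an almost-grading of the Lie algebra `L` over `S`. -/
def IsAlmostGrading {L : Type*} [LieRing L] [LieAlgebra S L] (gr : ℤ → Submodule S L) : Prop :=
  DirectSum.IsInternal gr ∧ (∀ n, Module.Finite S (gr n)) ∧
    ∃ r s : ℤ, ∀ n m : ℤ, ∀ x ∈ gr n, ∀ y ∈ gr m,
      ⁅x, y⁆ ∈ ⨆ h ∈ Set.Icc (n + m + r) (n + m + s), gr h

/-- A central extension `0 → S → E → L → 0` of a Lie algebra `L` over `S`. -/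
structure CentralExtension (L : Type*) [LieRing L] [LieAlgebra S L] where
  /-- The extended algebra. -/
  E : Type*
  [instLieRing : LieRing E]
  [instLieAlgebra : LieAlgebra S E]
  /-- The inclusion of the center; `incl 1` is the central element `t`. -/
  incl : S →ₗ[S] E
  /-- The projection. -/
  proj : E →ₗ⁅S⁆ L
  incl_injective : Function.Injective incl
  proj_surjective : Function.Surjective proj
  exact : ∀ x, proj x = 0 ↔ x ∈ LinearMap.range incl
  central : ∀ (r : S) (x : E), ⁅incl r, x⁆ = 0

attribute [instance] CentralExtension.instLieRing CentralExtension.instLieAlgebra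

namespace CentralExtension

variable {S} {L : Type*} [LieRing L] [LieAlgebra S L]

/-- Equivalence of central extensions: an isomorphism of Lie algebras which is the identity on the
center and on the quotient. -/
def Equivalent (C D : CentralExtension S L) : Prop :=
  ∃ φ : C.E ≃ₗ⁅S⁆ D.E, (∀ r, φ (C.incl r) = D.incl r) ∧ ∀ x, D.proj (φ x) = C.proj x

/-- The central extension is almost-graded with respect to `gr`: the grading `gr` of the quotient
extends to an almost-grading of the extended algebra in which the central element is homogeneous. -/
def IsAlmostGraded (C : CentralExtension S L) (gr : ℤ → Submodule S L) : Prop :=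
  ∃ grE : ℤ → Submodule S C.E, IsAlmostGrading S grE ∧
    (∀ n, (grE n).map (C.proj : C.E →ₗ[S] L) = gr n) ∧ ∃ d, C.incl 1 ∈ grE d

open LieModule.Cohomology in
/-- The central extension given by a 2-cocycle `ψ`, with bracket
`⁅(x, r), (y, s)⁆ = (⁅x, y⁆, ψ x y)`. -/
def ofCocycle (ψ : twoCocycle S L (TrivialLieModule S L S)) : CentralExtension S L where
  E := LieAlgebra.ofTwoCocycle ψ
  incl :=
    { toFun r := LieAlgebra.ofProd ψ (0, (TrivialLieModule.equiv S L S).symm r)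
      map_add' _ _ := by simp [← LieAlgebra.of_add]
      map_smul' c r := by
        rw [map_smul, RingHom.id_apply, ← LieAlgebra.of_smul, Prod.smul_mk, smul_zero] }
  proj :=
    { toFun x := ((LieAlgebra.ofProd ψ).symm x).1
      map_add' _ _ := rfl
      map_smul' _ _ := rfl
      map_lie' := rfl }
  incl_injective r s h := by simpa using h
  proj_surjective x := ⟨LieAlgebra.ofProd ψ (x, 0), rfl⟩
  exact x := by
    constructor
    · intro h
      refine ⟨TrivialLieModule.equiv S L S ((LieAlgebra.ofProd ψ).symm x).2, ?_⟩
      apply (LieAlgebra.ofProd ψ).symm.injective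
      exact Prod.ext (Eq.symm h) rfl
    · rintro ⟨r, rfl⟩
      rfl
  central r x := by
    simp only [LinearMap.coe_mk, AddHom.coe_mk, LieAlgebra.bracket_ofTwoCocycle,
      Equiv.symm_apply_apply, zero_lie, trivial_lie_zero]
    simp only [map_zero, LinearMap.zero_apply, add_zero, sub_zero]
    rfl

end CentralExtension

end Extension

/-! ### The geometric central extensions -/

section Affine

variable {S : Type*} [CommRing S] [Algebra ℂ S] (e₁ e₂ : S)
variable {g : Type*} [LieRing g] [LieAlgebra ℂ g]

/-- The bilinear form `(f ⊗ x, h ⊗ y) ↦ p β(x, y) (2πi)⁻¹ ∫ f dh` on the current algebra. -/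
def affineForm (β : LinearMap.BilinForm ℂ g) (p : S) :
    LinearMap.BilinForm S (CurrentAlgebra S e₁ e₂ g) :=
  p • ((cycleForm e₁ e₂).tmul β : LinearMap.BilinForm S (FunctionAlgebra S e₁ e₂ ⊗[ℂ] g))

lemma affineForm_tmul (β : LinearMap.BilinForm ℂ g) (p : S) (f h : FunctionAlgebra S e₁ e₂)
    (x y : g) : affineForm e₁ e₂ β p (.tmul f x) (.tmul h y) =
      p * (β x y • cycleForm e₁ e₂ f h) :=
  rfl

lemma affineForm_skew (β : LinearMap.BilinForm ℂ g) (hsymm : ∀ x y, β x y = β y x) (p : S)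
    (u v : CurrentAlgebra S e₁ e₂ g) :
    affineForm e₁ e₂ β p u v = -affineForm e₁ e₂ β p v u := by
  induction u using CurrentAlgebra.induction with
  | h f x =>
    induction v using CurrentAlgebra.induction with
    | h f' y =>
      rw [affineForm_tmul, affineForm_tmul, hsymm, cycleForm_skew, smul_neg, mul_neg]
    | hadd v v' hv hv' => simp only [map_add, LinearMap.add_apply, hv, hv']; ring
  | hadd u u' hu hu' => simp only [map_add, LinearMap.add_apply, hu, hu']; ring

lemma affineForm_self (β : LinearMap.BilinForm ℂ g) (hsymm : ∀ x y, β x y = β y x) (p : S)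
    (u : CurrentAlgebra S e₁ e₂ g) : affineForm e₁ e₂ β p u u = 0 := by
  have h : (2 : ℂ) • affineForm e₁ e₂ β p u u = 0 := by
    rw [two_smul]
    nth_rewrite 1 [affineForm_skew e₁ e₂ β hsymm p u u]
    exact neg_add_cancel _
  simpa using congrArg (fun r => (2⁻¹ : ℂ) • r) h

lemma affineForm_cocycle (β : LinearMap.BilinForm ℂ g) (hsymm : ∀ x y, β x y = β y x)
    (hinv : ∀ x y z, β ⁅x, y⁆ z = β x ⁅y, z⁆) (p : S) (u v w : CurrentAlgebra S e₁ e₂ g) :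
    affineForm e₁ e₂ β p ⁅u, v⁆ w + affineForm e₁ e₂ β p ⁅v, w⁆ u
      + affineForm e₁ e₂ β p ⁅w, u⁆ v = 0 := by
  induction u using CurrentAlgebra.induction with
  | h f x =>
    induction v using CurrentAlgebra.induction with
    | h f' y =>
      induction w using CurrentAlgebra.induction with
      | h f'' z =>
        simp only [CurrentAlgebra.lie_tmul, affineForm_tmul]
        have h1 : β ⁅y, z⁆ x = β ⁅x, y⁆ z := by rw [hinv x, hsymm]
        have h2 : β ⁅z, x⁆ y = β ⁅x, y⁆ z := by rw [hinv z, hsymm]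
        rw [h1, h2, ← mul_add, ← mul_add, ← smul_add, ← smul_add, cycleForm_mul, smul_zero,
          mul_zero]
      | hadd v v' hv hv' =>
        simp only [add_lie, lie_add, map_add, LinearMap.add_apply]
        linear_combination hv + hv'
    | hadd v v' hv hv' =>
      simp only [add_lie, lie_add, map_add, LinearMap.add_apply]
      linear_combination hv + hv'
  | hadd v v' hv hv' =>
    simp only [add_lie, lie_add, map_add, LinearMap.add_apply]
    linear_combination hv + hv'

open LieModule.Cohomology in
/-- For an invariant symmetric bilinear form `β` on `g`, the form `affineForm` is a 2-cocycle. -/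
def affineCocycle (β : LinearMap.BilinForm ℂ g) (hsymm : ∀ x y, β x y = β y x)
    (hinv : ∀ x y z, β ⁅x, y⁆ z = β x ⁅y, z⁆) (p : S) :
    twoCocycle S (CurrentAlgebra S e₁ e₂ g) (TrivialLieModule S (CurrentAlgebra S e₁ e₂ g) S) where
  val :=
    { val := (affineForm e₁ e₂ β p).compr₂
        (TrivialLieModule.equiv S (CurrentAlgebra S e₁ e₂ g) S).symm.toLinearMap
      property := affineForm_self e₁ e₂ β hsymm p }
  property := by
    rw [mem_twoCocycle_iff_of_trivial]
    intro u v w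
    refine congrArg (TrivialLieModule.equiv S (CurrentAlgebra S e₁ e₂ g) S).symm
      (?_ : affineForm e₁ e₂ β p u ⁅v, w⁆ =
        affineForm e₁ e₂ β p ⁅u, v⁆ w + affineForm e₁ e₂ β p v ⁅u, w⁆)
    have h := affineForm_cocycle e₁ e₂ β hsymm hinv p u v w
    rw [affineForm_skew e₁ e₂ β hsymm p u, affineForm_skew e₁ e₂ β hsymm p v, ← lie_skew u w,
      map_neg, LinearMap.neg_apply]
    linear_combination -h

/-- The central extension of the current algebra with bracket
`⁅f ⊗ x, h ⊗ y⁆ = f h ⊗ ⁅x, y⁆ + p β(x, y) (2πi)⁻¹ ∫ f dh • t`. -/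
def affineExtension (β : LinearMap.BilinForm ℂ g) (hsymm : ∀ x y, β x y = β y x)
    (hinv : ∀ x y z, β ⁅x, y⁆ z = β x ⁅y, z⁆) (p : S) :
    CentralExtension S (CurrentAlgebra S e₁ e₂ g) :=
  .ofCocycle (affineCocycle e₁ e₂ β hsymm hinv p)

variable (g) in
/-- The central extension of the current algebra for the Cartan-Killing form of `g`. -/
def killingExtension (p : S) : CentralExtension S (CurrentAlgebra S e₁ e₂ g) :=
  affineExtension e₁ e₂ (killingForm ℂ g) (LieModule.traceForm_comm ℂ g g)
    (LieModule.traceForm_apply_lie_apply ℂ g g) p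

end Affine

/-! ### The separating cycle on a fibre -/

section Cycle

variable (e₁ e₂ : ℂ)

/-- The points near `∞` of the cubic `Y² = 4 (X - e₁) (X - e₂) (X - e₃)`, `e₃ = -(e₁ + e₂)`, in
terms of the local coordinate `z = (X - e₁) ^ (-1/2)` at `∞`. -/
def cubicPoint (z : ℂ) : ℂ × ℂ :=
  (e₁ + z ^ (-2 : ℤ),
    2 * z ^ (-3 : ℤ) *
      (1 + 3 * e₁ * z ^ 2 + (e₁ - e₂) * (2 * e₁ + e₂) * z ^ 4) ^ (1 / 2 : ℂ))

lemma cubicPoint_mem {z : ℂ} (hz : z ≠ 0) :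
    (cubicPoint e₁ e₂ z).2 ^ 2 = 4 * ((cubicPoint e₁ e₂ z).1 - e₁) *
      ((cubicPoint e₁ e₂ z).1 - e₂) * ((cubicPoint e₁ e₂ z).1 + (e₁ + e₂)) := by
  have h (w : ℂ) : (w ^ (1 / 2 : ℂ)) ^ 2 = w := by
    rw [← Complex.cpow_nat_mul]; simp
  rw [cubicPoint, mul_pow, h]
  field_simp
  ring

/-- The function `A n` on the cubic, in terms of the affine coordinates `X`, `Y`. -/
def basisFunction (n : ℤ) (P : ℂ × ℂ) : ℂ :=
  if Even n then (P.1 - e₁) ^ (n / 2) else 1 / 2 * P.2 * (P.1 - e₁) ^ (n / 2 - 1)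

/-- The integral `(2πi)⁻¹ ∫ A_n dA_m` over a cycle separating `(e₁, 0)` from `∞`, positively oriented
around `(e₁, 0)`. As the cycle one takes the circle of radius `r` around `∞` in the coordinate `z`,
with the orientation reversed. -/
def separatingIntegral (r : ℝ) (n m : ℤ) : ℂ :=
  (2 * Real.pi * Complex.I)⁻¹ *
    -∮ z in C(0, r), basisFunction e₁ n (cubicPoint e₁ e₂ z) *
      deriv (fun w => basisFunction e₁ m (cubicPoint e₁ e₂ w)) z

end Cycle

end EllipticCurrent

end

/-!
Everything except the contour integral is proved at once for the family and for its members, over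
an arbitrary commutative `ℂ`-algebra `S` with parameters `e₁, e₂ : S`.

*Existence of gradings.* A central extension with a linear section is described by a 2-cocycle
(`CentralExtension.IsSection`). If the cocycle vanishes outside a strip `r ≤ n + m ≤ s`, the
extension is almost-graded, with the central element in degree `0`
(`CentralExtension.IsSection.isAlmostGraded`). The geometric cocycles live in `0 ≤ n + m ≤ 4`.

*Classification.* The grading of an almost-graded extension provides a section of the current
algebra which respects degrees; as `S t` lies in a single degree, its cocycle `ψ` vanishes on
`A n ⊗ x`, `A m ⊗ y` when `n + m ≪ 0` (`exists_local_isSection`). For fixed `f` the map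
`x ↦ ψ (1 ⊗ x) (f ⊗ ·)` is a 1-cocycle of `g` with values in its dual. By Cartan's criterion the
Killing form identifies it with a derivation, which is inner, so that a coboundary makes `ψ`
vanish on `1 ⊗ g` without destroying the vanishing in low degrees
(`exists_normalized_isSection`). Then `(x, y) ↦ ψ (f ⊗ x) (h ⊗ y)` is an invariant form on `g`, and
by Schur's lemma it equals `κ(x, y) γ(f, h)`, where `γ` is skew and
`γ(fg, h) + γ(gh, f) + γ(hf, g) = 0` (`exists_eq_killingForm_smul_cyclicForm`).

Such a `γ` is a functional `f dg ↦ γ(f, g)` on differentials modulo exact ones. With `T = A 2` and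
`ω = A 1`, the values on `Tⁱ dTʲ` are multiples of a residue, since `dTᵏ` is exact. They determine
the values on `ω Tⁱ d(ω Tʲ)`, because `ω dω = d(ω²) / 2`. The values `d k` on `ω Tᵏ⁻¹ dT` satisfy a
three-term recursion `(2i + 3) d (i + 1) = …` which comes from differentiating the equation
of the curve; its leading coefficient never vanishes, so that vanishing for `k ≪ 0` implies
`d = 0`. No condition on `e₁`, `e₂` is needed, and degenerate cubics are included. Hence `γ` is a
multiple of the integral over the separating cycle (`IsCyclicForm.exists_eq_smul_cycleForm`).

*Uniqueness.* On commuting elements a cocycle is the bracket of arbitrary lifts, so that its value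
on `A 2 ⊗ x`, `A (-2) ⊗ x` depends on the extension only; this value is `-2 p κ(x, x)`
(`killingExtension_param_unique`).

*The integral.* In the local coordinate `z` at `∞` one has `A n = z⁻ⁿ` for even `n` and
`A n = z⁻ⁿ √q` for odd `n`, with `q = 1 + 3 e₁ z² + (e₁ - e₂) (2 e₁ + e₂) z⁴`. For equal
parities the integrand is a Laurent polynomial in `z`; for different parities it is an even function
of `z`, whose integral over a circle around `0` vanishes.
-/

noncomputable section

namespace EllipticCurrent

/-! ### Invariant forms and cocycles of a simple Lie algebra -/

section SimpleLieAlgebra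

variable {g : Type*} [LieRing g] [LieAlgebra ℂ g] [FiniteDimensional ℂ g] [LieAlgebra.IsSimple ℂ g]

lemma killingForm_nondegenerate_of_isSimple : (killingForm ℂ g).Nondegenerate :=
  LieAlgebra.IsKilling.killingForm_nondegenerate ℂ g

lemma eq_of_killingForm_eq {x y : g} (h : ∀ z, killingForm ℂ g x z = killingForm ℂ g y z) :
    x = y := by
  rw [← sub_eq_zero]
  exact (killingForm_nondegenerate_of_isSimple (g := g)).1 _ fun z => by simp [h z]

/-- A linear map into the dual of `g` is represented by an endomorphism through the Killing form. -/
lemma exists_killingForm_repr (β : LinearMap.BilinForm ℂ g) :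
    ∃ T : g →ₗ[ℂ] g, ∀ x y, killingForm ℂ g (T x) y = β x y := by
  have hnd := killingForm_nondegenerate_of_isSimple (g := g)
  refine ⟨(LinearMap.BilinForm.toDual (killingForm ℂ g) hnd).symm.toLinearMap ∘ₗ β, fun x y => ?_⟩
  simp

omit [FiniteDimensional ℂ g] in
variable (g) in
lemma exists_lie_ne_zero : ∃ x y : g, ⁅x, y⁆ ≠ 0 := by
  by_contra! h
  exact LieAlgebra.IsSimple.non_abelian ℂ (L := g) ⟨fun x y => h x y⟩

variable (g) in
lemma exists_killingForm_lie_ne_zero : ∃ x y z : g, killingForm ℂ g ⁅x, y⁆ z ≠ 0 := by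
  obtain ⟨x, y, h⟩ := exists_lie_ne_zero g
  by_contra! h'
  exact h (eq_of_killingForm_eq (fun z => by simp [h' x y z]))

variable (g) in
lemma exists_killingForm_self_ne_zero : ∃ x : g, killingForm ℂ g x x ≠ 0 := by
  by_contra! h
  obtain ⟨x, y, z, hxyz⟩ := exists_killingForm_lie_ne_zero g
  have h1 := h (⁅x, y⁆ + z)
  have h2 := LieModule.traceForm_comm ℂ g g ⁅x, y⁆ z
  simp only [map_add, LinearMap.add_apply, h, zero_add, add_zero] at h1
  change killingForm ℂ g ⁅x, y⁆ z = killingForm ℂ g z ⁅x, y⁆ at h2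
  rw [← h2] at h1
  exact hxyz (by linear_combination h1 / 2)

/-- Schur's lemma: representing the form by an endomorphism `T` through the Killing form, `T`
commutes with the adjoint action, so that an eigenspace of `T` is a nonzero ideal. -/
theorem exists_eq_smul_killingForm (β : LinearMap.BilinForm ℂ g)
    (hinv : ∀ x y z, β ⁅x, y⁆ z = β x ⁅y, z⁆) : ∃ c : ℂ, β = c • killingForm ℂ g := by
  obtain ⟨T, hT⟩ := exists_killingForm_repr β
  have hcomm (x y : g) : T ⁅x, y⁆ = ⁅T x, y⁆ := by
    apply eq_of_killingForm_eq
    intro z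
    rw [hT, hinv, ← hT]
    exact (LieModule.traceForm_apply_lie_apply ℂ g g _ _ _).symm
  obtain ⟨x₀, y₀, hxy⟩ := exists_lie_ne_zero g
  have : Nontrivial g := ⟨_, _, hxy⟩
  obtain ⟨c, hc⟩ := Module.End.exists_eigenvalue T
  let I : LieIdeal ℂ g :=
    { Module.End.eigenspace T c with
      lie_mem := by
        intro x y hy
        change y ∈ Module.End.eigenspace T c at hy
        change ⁅x, y⁆ ∈ Module.End.eigenspace T c
        rw [Module.End.mem_eigenspace_iff] at hy ⊢
        rw [← lie_skew, map_neg, hcomm, hy, smul_lie, smul_neg] }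
  have hI : I = ⊤ := by
    refine (LieAlgebra.IsSimple.eq_bot_or_eq_top I).resolve_left fun h => ?_
    obtain ⟨v, hv⟩ := hc.exists_hasEigenvector
    have hvI : v ∈ I := hv.1
    rw [h] at hvI
    exact hv.2 (by simpa using hvI)
  refine ⟨c, LinearMap.ext₂ fun x y => ?_⟩
  have hx : x ∈ Module.End.eigenspace T c := by
    change x ∈ I
    simp [hI]
  rw [Module.End.mem_eigenspace_iff] at hx
  rw [← hT, hx]
  simp

section Valued

variable {M : Type*} [AddCommGroup M] [Module ℂ M]

/-- The vector-valued form is tested against all linear functionals. -/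
theorem exists_eq_killingForm_smul (B : g →ₗ[ℂ] g →ₗ[ℂ] M)
    (hinv : ∀ x y z, B ⁅x, y⁆ z = B x ⁅y, z⁆) :
    ∃ m : M, ∀ x y, B x y = killingForm ℂ g x y • m := by
  obtain ⟨x₀, h₀⟩ := exists_killingForm_self_ne_zero g
  refine ⟨(killingForm ℂ g x₀ x₀)⁻¹ • B x₀ x₀, fun x y => ?_⟩
  rw [← sub_eq_zero, ← Module.forall_dual_apply_eq_zero_iff ℂ]
  intro l
  obtain ⟨c, hc⟩ := exists_eq_smul_killingForm (B.compr₂ l) fun x y z => by simp [hinv]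
  have hc' (x y : g) : l (B x y) = c * killingForm ℂ g x y := by
    simpa using congr($hc x y)
  rw [map_sub, map_smul, map_smul, hc', hc', smul_eq_mul, smul_eq_mul]
  field_simp
  ring

lemma exists_eq_apply_lie_scalar (B : LinearMap.BilinForm ℂ g)
    (hB : ∀ x y z, B ⁅x, y⁆ z = B x ⁅y, z⁆ - B y ⁅x, z⁆) :
    ∃ φ : g →ₗ[ℂ] ℂ, ∀ x y : g, B x y = φ ⁅x, y⁆ := by
  obtain ⟨T, hT⟩ := exists_killingForm_repr B
  have hκ : ∀ x y z, killingForm ℂ g ⁅x, y⁆ z = killingForm ℂ g x ⁅y, z⁆ :=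
    LieModule.traceForm_apply_lie_apply ℂ g g
  let D : LieDerivation ℂ g g :=
    { T with
      leibniz' := by
        intro x y
        change T ⁅x, y⁆ = ⁅x, T y⁆ - ⁅y, T x⁆
        apply eq_of_killingForm_eq
        intro z
        rw [hT, hB, ← hT, ← hT, ← hκ, ← hκ, ← lie_skew x, ← lie_skew y]
        simp only [map_sub, map_neg, LinearMap.sub_apply, LinearMap.neg_apply]
        ring }
  obtain ⟨z, hz⟩ := LieDerivation.IsKilling.exists_eq_ad D
  refine ⟨killingForm ℂ g z, fun x y => ?_⟩
  have hx : T x = ⁅z, x⁆ := by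
    change D x = _
    rw [← hz]
    simp
  rw [← hT, hx, hκ]

omit [FiniteDimensional ℂ g] in
variable (g) in
lemma surjective_toModuleHom : Function.Surjective (LieModule.toModuleHom ℂ g g) := by
  have h : ⁅(⊤ : LieIdeal ℂ g), (⊤ : LieIdeal ℂ g)⁆ = ⊤ := by
    refine (LieAlgebra.IsSimple.eq_bot_or_eq_top _).resolve_left fun h => ?_
    obtain ⟨x, y, hxy⟩ := exists_lie_ne_zero g
    have : ⁅x, y⁆ ∈ ⁅(⊤ : LieIdeal ℂ g), (⊤ : LieIdeal ℂ g)⁆ :=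
      LieSubmodule.lie_mem_lie (LieSubmodule.mem_top x) (LieSubmodule.mem_top y)
    rw [h] at this
    exact hxy (by simpa using this)
  intro x
  have hx : x ∈ (⁅(⊤ : LieIdeal ℂ g), (⊤ : LieIdeal ℂ g)⁆ : LieSubmodule ℂ g g).toSubmodule := by
    rw [h]; trivial
  rw [LieSubmodule.lieIdeal_oper_eq_linear_span'] at hx
  induction hx using Submodule.span_induction with
  | mem x hx =>
    obtain ⟨y, -, z, -, rfl⟩ := hx
    exact ⟨y ⊗ₜ z, by simp⟩
  | zero => exact ⟨0, by simp⟩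
  | add x y _ _ hx hy =>
    obtain ⟨a, rfl⟩ := hx
    obtain ⟨b, rfl⟩ := hy
    exact ⟨a + b, by simp⟩
  | smul c x _ hx =>
    obtain ⟨a, rfl⟩ := hx
    exact ⟨c • a, by simp⟩

omit [FiniteDimensional ℂ g] in
lemma linearMap_ext_of_lie {φ ψ : g →ₗ[ℂ] M} (h : ∀ x y : g, φ ⁅x, y⁆ = ψ ⁅x, y⁆) : φ = ψ := by
  have h' : φ ∘ₗ (LieModule.toModuleHom ℂ g g : g ⊗[ℂ] g →ₗ[ℂ] g)
      = ψ ∘ₗ (LieModule.toModuleHom ℂ g g : g ⊗[ℂ] g →ₗ[ℂ] g) :=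
    TensorProduct.ext' fun x y => by simpa using h x y
  refine LinearMap.ext fun x => ?_
  obtain ⟨t, rfl⟩ := surjective_toModuleHom g x
  exact congr($h' t)

/-- The vanishing of the first cohomology of `g` with values in the dual of `g` (and hence in
`g →ₗ[ℂ] M`): through the Killing form a 1-cocycle is a derivation of `g`, and derivations are
inner. -/
theorem exists_eq_apply_lie (B : g →ₗ[ℂ] g →ₗ[ℂ] M)
    (hB : ∀ x y z, B ⁅x, y⁆ z = B x ⁅y, z⁆ - B y ⁅x, z⁆) :
    ∃ φ : g →ₗ[ℂ] M, ∀ x y : g, B x y = φ ⁅x, y⁆ := by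
  obtain ⟨s, hs⟩ := LinearMap.exists_rightInverse_of_surjective
    (LieModule.toModuleHom ℂ g g : g ⊗[ℂ] g →ₗ[ℂ] g)
    (LinearMap.range_eq_top.mpr (surjective_toModuleHom g))
  refine ⟨TensorProduct.lift B ∘ₗ s, fun x y => ?_⟩
  rw [← sub_eq_zero, ← Module.forall_dual_apply_eq_zero_iff ℂ]
  intro l
  obtain ⟨φ, hφ⟩ := exists_eq_apply_lie_scalar (B.compr₂ l) fun x y z => by simp [hB]
  have h : l ∘ₗ TensorProduct.lift B =
      φ ∘ₗ (LieModule.toModuleHom ℂ g g : g ⊗[ℂ] g →ₗ[ℂ] g) :=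
    TensorProduct.ext' fun x y => by simpa using hφ x y
  have h1 (u : g) : l (TensorProduct.lift B (s u)) = φ u :=
    (LinearMap.congr_fun h (s u)).trans (congrArg φ (LinearMap.congr_fun hs u))
  rw [map_sub, LinearMap.comp_apply, h1, sub_eq_zero]
  exact hφ x y

end Valued

end SimpleLieAlgebra

/-! ### Integration over the separating cycle -/

section SeparatingCycle

/-- The shift `θ ↦ θ + π` of the angle changes the sign of `f z dz`. -/
lemma circleIntegral_eq_zero_of_even {f : ℂ → ℂ} (hf : ∀ z, f (-z) = f z) (r : ℝ) :
    ∮ z in C(0, r), f z = 0 := by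
  have hneg (θ : ℝ) : circleMap 0 r (θ + Real.pi) = -circleMap 0 r θ := by
    simp [circleMap, add_mul, Complex.exp_add]
  set F : ℝ → ℂ := fun θ => deriv (circleMap 0 r) θ • f (circleMap 0 r θ) with hF
  have hshift (θ : ℝ) : F (θ + Real.pi) = -F θ := by
    simp [hF, deriv_circleMap, hneg, hf]
  have hper : Function.Periodic F (2 * Real.pi) := fun θ => by
    rw [two_mul, ← add_assoc, hshift, hshift, neg_neg]
  have h1 : ∫ θ in (0 : ℝ)..2 * Real.pi, F (θ + Real.pi) = ∫ θ in (0 : ℝ)..2 * Real.pi, F θ := by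
    rw [intervalIntegral.integral_comp_add_right, add_comm (2 * Real.pi), zero_add]
    simpa using hper.intervalIntegral_add_eq Real.pi 0
  simp only [hshift, intervalIntegral.integral_neg] at h1
  exact self_eq_neg.mp h1.symm

lemma circleIntegral_zpow {r : ℝ} (hr : 0 < r) (k : ℤ) :
    ∮ z in C(0, r), z ^ k = if k = -1 then 2 * Real.pi * Complex.I else 0 := by
  split_ifs with h
  · subst h
    simpa using circleIntegral.integral_sub_center_inv (0 : ℂ) hr.ne'
  · simpa using circleIntegral.integral_sub_zpow_of_ne h 0 0 r

lemma circleIntegrable_zpow {r : ℝ} (hr : 0 < r) (k : ℤ) :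
    CircleIntegrable (fun z : ℂ => z ^ k) 0 r := by
  simpa using (circleIntegrable_sub_zpow_iff (c := 0) (w := 0) (R := r) (n := k)).mpr
    (Or.inr (Or.inr (by simpa using (abs_pos.mpr hr.ne').ne)))

variable (e₁ e₂ : ℂ)

/-- The polynomial `q` with `(Y / (2 z ^ (-3))) ^ 2 = q z` on the cubic. -/
def localCubic (z : ℂ) : ℂ := 1 + 3 * e₁ * z ^ 2 + (e₁ - e₂) * (2 * e₁ + e₂) * z ^ 4

lemma hasDerivAt_localCubic (z : ℂ) : HasDerivAt (localCubic e₁ e₂)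
    (6 * e₁ * z + 4 * ((e₁ - e₂) * (2 * e₁ + e₂)) * z ^ 3) z := by
  have h := (((hasDerivAt_pow 2 z).const_mul (3 * e₁)).const_add 1).add
    ((hasDerivAt_pow 4 z).const_mul ((e₁ - e₂) * (2 * e₁ + e₂)))
  refine h.congr_deriv ?_
  norm_num
  ring

/-- In the local coordinate at `∞` one has `A_n = z ^ (-n)` for even `n` and
`A_n = z ^ (-n) √(q z)` for odd `n`. -/
lemma basisFunction_cubicPoint (n : ℤ) {z : ℂ} (hz : z ≠ 0) :
    basisFunction e₁ n (cubicPoint e₁ e₂ z) =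
      z ^ (-n) * (if Even n then 1 else localCubic e₁ e₂ z ^ (1 / 2 : ℂ)) := by
  obtain ⟨k, rfl | rfl⟩ := Int.even_or_odd' n
  · rw [basisFunction, if_pos (by simp), if_pos (by simp), cubicPoint, add_sub_cancel_left,
      ← zpow_mul, mul_one]
    congr 1
    omega
  · rw [basisFunction, if_neg (by simp), if_neg (by simp), cubicPoint, add_sub_cancel_left,
      ← zpow_mul, ← localCubic, show -(2 * k + 1) = -3 + -2 * ((2 * k + 1) / 2 - 1) by omega,
      zpow_add₀ hz]
    ring

lemma basisFunction_cubicPoint_neg (n : ℤ) (z : ℂ) :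
    basisFunction e₁ n (cubicPoint e₁ e₂ (-z)) =
      (if Even n then 1 else -1) * basisFunction e₁ n (cubicPoint e₁ e₂ z) := by
  have h2 : (-z) ^ (-2 : ℤ) = z ^ (-2 : ℤ) := Even.neg_zpow (by decide) z
  have h3 : (-z) ^ (-3 : ℤ) = -z ^ (-3 : ℤ) := Odd.neg_zpow (by decide) z
  have h4 : (-z) ^ 4 = z ^ 4 := Even.neg_pow (by decide) z
  unfold basisFunction cubicPoint
  split_ifs <;> simp only [h2, h3, h4, neg_sq] <;> ring

lemma deriv_basisFunction_neg (n : ℤ) (z : ℂ) :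
    deriv (fun w => basisFunction e₁ n (cubicPoint e₁ e₂ w)) (-z) =
      -(if Even n then 1 else -1) * deriv (fun w => basisFunction e₁ n (cubicPoint e₁ e₂ w)) z := by
  have h := deriv_comp_neg (fun w => basisFunction e₁ n (cubicPoint e₁ e₂ w)) z
  simp only [basisFunction_cubicPoint_neg] at h
  rw [deriv_const_mul_field] at h
  rw [neg_mul, h, neg_neg]

lemma deriv_basisFunction_even {m : ℤ} (hm : Even m) {z : ℂ} (hz : z ≠ 0) :
    deriv (fun w => basisFunction e₁ m (cubicPoint e₁ e₂ w)) z = -m * z ^ (-m - 1) := by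
  have hev : (fun w => basisFunction e₁ m (cubicPoint e₁ e₂ w)) =ᶠ[nhds z] fun w => w ^ (-m) := by
    filter_upwards [eventually_ne_nhds hz] with w hw
    rw [basisFunction_cubicPoint e₁ e₂ m hw, if_pos hm, mul_one]
  rw [hev.deriv_eq, deriv_zpow]
  push_cast
  rfl

/-- The square root occurs in `A_n dA_m` for odd `n`, `m` only through its square and through
its product with its derivative, which is half the derivative of the square. -/
lemma basisFunction_mul_deriv_odd {n m : ℤ} (hn : Odd n) (hm : Odd m) {z : ℂ} (hz : z ≠ 0)
    (hq : localCubic e₁ e₂ z ∈ Complex.slitPlane) :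
    basisFunction e₁ n (cubicPoint e₁ e₂ z) *
        deriv (fun w => basisFunction e₁ m (cubicPoint e₁ e₂ w)) z =
      -m * z ^ (-n - m - 1) + 3 * e₁ * (-m + 1) * z ^ (-n - m + 1)
        + (e₁ - e₂) * (2 * e₁ + e₂) * (-m + 2) * z ^ (-n - m + 3) := by
  have hev : (fun w => basisFunction e₁ m (cubicPoint e₁ e₂ w)) =ᶠ[nhds z]
      fun w => w ^ (-m) * localCubic e₁ e₂ w ^ (1 / 2 : ℂ) := by
    filter_upwards [eventually_ne_nhds hz] with w hw
    rw [basisFunction_cubicPoint e₁ e₂ m hw, if_neg (by simpa using hm)]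
  have hd := (hasDerivAt_zpow (-m) z (Or.inl hz)).mul
    ((hasDerivAt_localCubic e₁ e₂ z).cpow_const (c := 1 / 2) hq)
  rw [hev.deriv_eq,
    show deriv (fun w => w ^ (-m) * localCubic e₁ e₂ w ^ (1 / 2 : ℂ)) z = _ from hd.deriv,
    basisFunction_cubicPoint e₁ e₂ n hz, if_neg (by simpa using hn)]
  have hq0 : localCubic e₁ e₂ z ≠ 0 := Complex.slitPlane_ne_zero hq
  set w := localCubic e₁ e₂ z ^ (1 / 2 : ℂ) with hw
  have hww : w * w = localCubic e₁ e₂ z := by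
    rw [hw, ← Complex.cpow_add _ _ hq0]
    norm_num
  have hww' : w * localCubic e₁ e₂ z ^ (1 / 2 - 1 : ℂ) = 1 := by
    rw [hw, ← Complex.cpow_add _ _ hq0]
    norm_num
  have e1 : z ^ (-n - m - 1) = z ^ (-n) * z ^ (-m) * z⁻¹ := by
    rw [← zpow_neg_one, ← zpow_add₀ hz, ← zpow_add₀ hz]; congr 1
  have e2 : z ^ (-n - m + 1) = z ^ (-n) * z ^ (-m) * z := by
    rw [← zpow_add₀ hz, ← zpow_add_one₀ hz]; congr 1
  have e3 : z ^ (-n - m + 3) = z ^ (-n) * z ^ (-m) * z ^ 3 := by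
    rw [← zpow_natCast, ← zpow_add₀ hz, ← zpow_add₀ hz]; congr 1
  have e4 : z ^ (-m - 1) = z ^ (-m) * z⁻¹ := by
    rw [← zpow_neg_one, ← zpow_add₀ hz]; congr 1
  have hz1 : z * z⁻¹ = 1 := mul_inv_cancel₀ hz
  rw [e1, e2, e3, e4]
  push_cast
  have hq' := hww
  rw [localCubic] at hq'
  linear_combination (-m * z ^ (-n) * z ^ (-m) * z⁻¹) * hq' +
    (z ^ (-n) * z ^ (-m) * (1 / 2 * (6 * e₁ * z + 4 * ((e₁ - e₂) * (2 * e₁ + e₂)) * z ^ 3))) * hww'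
    - m * z ^ (-n) * z ^ (-m) * (3 * e₁ * z + (e₁ - e₂) * (2 * e₁ + e₂) * z ^ 3) * hz1

/-- For indices of different parity the integrand is an even function of the local coordinate. -/
lemma separatingIntegral_of_parity_ne {n m : ℤ} (h : ¬(Even n ↔ Even m)) (r : ℝ) :
    separatingIntegral e₁ e₂ r n m = 0 := by
  rw [separatingIntegral, circleIntegral_eq_zero_of_even, neg_zero, mul_zero]
  intro z
  rw [deriv_basisFunction_neg, basisFunction_cubicPoint_neg]
  by_cases hn : Even n <;> by_cases hm : Even m <;> simp only [hn, hm, not_true] at h <;>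
    simp only [hn, hm, if_true, if_false] <;> ring

lemma separatingIntegral_even {n m : ℤ} (hn : Even n) (hm : Even m) {r : ℝ} (hr : 0 < r) :
    separatingIntegral e₁ e₂ r n m = cycleValue e₁ e₂ n m := by
  have h : ∮ z in C(0, r), basisFunction e₁ n (cubicPoint e₁ e₂ z) *
      deriv (fun w => basisFunction e₁ m (cubicPoint e₁ e₂ w)) z =
      ∮ z in C(0, r), (-m : ℂ) * z ^ (-n - m - 1) := by
    refine circleIntegral.integral_congr hr.le fun z hz => ?_
    have hz0 : z ≠ 0 := by
      rintro rfl
      simp [hr.ne] at hz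
    rw [deriv_basisFunction_even e₁ e₂ hm hz0, basisFunction_cubicPoint e₁ e₂ n hz0, if_pos hn,
      show -n - m - 1 = -n + (-m - 1) by ring, zpow_add₀ hz0]
    ring
  rw [separatingIntegral, h, circleIntegral.integral_const_mul, circleIntegral_zpow hr,
    show cycleValue e₁ e₂ n m = if m = -n then -(n : ℂ) else 0 from if_pos ⟨hn, hm⟩]
  have hpi := Complex.two_pi_I_ne_zero
  by_cases hnm : m = -n
  · subst hnm
    rw [if_pos (by ring), if_pos rfl]
    field_simp
    push_cast
    ring
  · rw [if_neg (by omega), if_neg hnm]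
    simp

lemma separatingIntegral_odd {n m : ℤ} (hn : Odd n) (hm : Odd m) {r : ℝ} (hr : 0 < r)
    (hq : ∀ z ∈ Metric.sphere (0 : ℂ) r, localCubic e₁ e₂ z ∈ Complex.slitPlane) :
    separatingIntegral e₁ e₂ r n m = cycleValue e₁ e₂ n m := by
  have h : ∮ z in C(0, r), basisFunction e₁ n (cubicPoint e₁ e₂ z) *
      deriv (fun w => basisFunction e₁ m (cubicPoint e₁ e₂ w)) z =
      ∮ z in C(0, r), ((-m * z ^ (-n - m - 1) + 3 * e₁ * (-m + 1) * z ^ (-n - m + 1))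
        + (e₁ - e₂) * (2 * e₁ + e₂) * (-m + 2) * z ^ (-n - m + 3)) := by
    refine circleIntegral.integral_congr hr.le fun z hz => ?_
    have hz0 : z ≠ 0 := by
      rintro rfl
      simp [hr.ne] at hz
    exact basisFunction_mul_deriv_odd e₁ e₂ hn hm hz0 (hq z hz)
  have hi (c : ℂ) (k : ℤ) : CircleIntegrable (fun z : ℂ => c * z ^ k) 0 r :=
    (circleIntegrable_zpow hr k).const_mul c
  have hi₂ (c d : ℂ) (k l : ℤ) : CircleIntegrable (fun z : ℂ => c * z ^ k + d * z ^ l) 0 r :=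
    (hi c k).add (hi d l)
  rw [separatingIntegral, h, circleIntegral.integral_add (hi₂ _ _ _ _) (hi _ _),
    circleIntegral.integral_add (hi _ _) (hi _ _)]
  simp only [circleIntegral.integral_const_mul, circleIntegral_zpow hr]
  have hval : cycleValue e₁ e₂ n m = (if m = -n then -(n : ℂ) else 0)
      + (if m = -n + 2 then 3 * e₁ * (-(n : ℂ) + 1) else 0)
      + (if m = -n + 4 then (e₁ - e₂) * (2 * e₁ + e₂) * (-(n : ℂ) + 2) else 0) := by
    rw [cycleValue, if_neg fun h => Int.not_even_iff_odd.mpr hn h.1, if_pos ⟨hn, hm⟩]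
  rw [hval]
  have hpi := Complex.two_pi_I_ne_zero
  have c1 : -n - m - 1 = -1 ↔ m = -n := by omega
  have c2 : -n - m + 1 = -1 ↔ m = -n + 2 := by omega
  have c3 : -n - m + 3 = -1 ↔ m = -n + 4 := by omega
  simp only [c1, c2, c3, mul_ite, mul_zero]
  rw [inv_mul_eq_iff_eq_mul₀ hpi]
  by_cases h1 : m = -n
  · subst h1
    simp
    ring
  by_cases h2 : m = -n + 2
  · subst h2
    simp
    ring
  by_cases h4 : m = -n + 4
  · subst h4
    simp
    ring
  simp [h1, h2, h4]

/-- Near `∞` the principal branch of `√q` is holomorphic, since `q` is close to `1`. -/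
theorem exists_separatingIntegral_eq_cycleValue :
    ∃ ρ > 0, ∀ r : ℝ, 0 < r → r < ρ → ∀ n m : ℤ,
      separatingIntegral e₁ e₂ r n m = cycleValue e₁ e₂ n m := by
  have hcont : ContinuousAt (localCubic e₁ e₂) 0 :=
    (hasDerivAt_localCubic e₁ e₂ 0).continuousAt
  have hmem : localCubic e₁ e₂ ⁻¹' Complex.slitPlane ∈ nhds 0 :=
    hcont.preimage_mem_nhds (Complex.isOpen_slitPlane.mem_nhds (by simp [localCubic]))
  obtain ⟨ρ, hρ, hball⟩ := Metric.mem_nhds_iff.mp hmem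
  refine ⟨ρ, hρ, fun r hr hrρ n m => ?_⟩
  by_cases hn : Even n <;> by_cases hm : Even m
  · exact separatingIntegral_even e₁ e₂ hn hm hr
  · rw [separatingIntegral_of_parity_ne e₁ e₂ (by simp [hn, hm]), cycleValue,
      if_neg (by simp [hm]), if_neg (by simp [hn])]
  · rw [separatingIntegral_of_parity_ne e₁ e₂ (by simp [hn, hm]), cycleValue,
      if_neg (by simp [hn]), if_neg (by simp [hm])]
  · refine separatingIntegral_odd e₁ e₂ (by simpa using hn) (by simpa using hm) hr fun z hz => ?_
    exact hball (Metric.sphere_subset_ball hrρ hz)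

end SeparatingCycle

/-! ### Cyclic forms on the function algebra -/

section CyclicForms

/-- A skew-symmetric bilinear form `γ` on a commutative algebra with
`γ (f g) h + γ (g h) f + γ (h f) g = 0`, that is, a functional `f dg ↦ γ f g` on the differentials
modulo the exact ones. -/
structure IsCyclicForm {S V : Type*} [CommRing S] [CommRing V] [Algebra S V]
    (γ : LinearMap.BilinForm S V) : Prop where
  skew : ∀ f h, γ f h = -γ h f
  cyclic : ∀ f g h, γ (f * g) h + γ (g * h) f + γ (h * f) g = 0

namespace IsCyclicForm

variable {S V : Type*} [CommRing S] [CommRing V] [Algebra S V] {γ γ' : LinearMap.BilinForm S V}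

lemma sub_smul (hγ : IsCyclicForm γ) (hγ' : IsCyclicForm γ') (p : S) :
    IsCyclicForm (γ - p • γ') where
  skew f h := by
    simp only [LinearMap.sub_apply, LinearMap.smul_apply, smul_eq_mul]
    linear_combination hγ.skew f h - p * hγ'.skew f h
  cyclic f g h := by
    simp only [LinearMap.sub_apply, LinearMap.smul_apply, smul_eq_mul]
    linear_combination hγ.cyclic f g h - p * hγ'.cyclic f g h

/-- The Leibniz rule `f d(gh) = (fg) dh + (fh) dg`. -/
lemma leibniz (hγ : IsCyclicForm γ) (f g h : V) : γ f (g * h) = γ (f * g) h + γ (f * h) g := by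
  have h1 := hγ.cyclic f g h
  rw [hγ.skew (g * h), mul_comm h f] at h1
  linear_combination -h1

lemma one_right (hγ : IsCyclicForm γ) (f : V) : γ f 1 = 0 := by
  simpa using hγ.leibniz f 1 1

end IsCyclicForm

variable {S : Type*} [CommRing S] [Algebra ℂ S] {e₁ e₂ : S}

lemma eq_zero_of_intCast_mul {n : ℤ} (hn : n ≠ 0) {x : S} (h : (n : S) * x = 0) : x = 0 := by
  have h' : (n : ℂ) • x = 0 := by
    rw [Algebra.smul_def, map_intCast, h]
  exact (smul_eq_zero.mp h').resolve_left (by exact_mod_cast hn)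

omit [Algebra ℂ S] in
lemma isCyclicForm_cycleForm : IsCyclicForm (cycleForm e₁ e₂) :=
  ⟨cycleForm_skew e₁ e₂, cycleForm_mul e₁ e₂⟩

omit [Algebra ℂ S] in
lemma A_zero : A S e₁ e₂ 0 = 1 := by
  have h := A_even (S := S) (e₁ := e₁) (e₂ := e₂) 0
  rw [mul_zero] at h
  rw [h, LaurentPolynomial.T_zero]
  rfl

omit [Algebra ℂ S] in
lemma A_odd_mul_even (i j : ℤ) :
    A S e₁ e₂ (2 * i + 1) * A S e₁ e₂ (2 * j) = A S e₁ e₂ (2 * (i + j) + 1) := by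
  rw [mul_comm, A_even_mul_odd, add_comm j]

namespace IsCyclicForm

variable {γ : LinearMap.BilinForm S (FunctionAlgebra S e₁ e₂)}

omit [Algebra ℂ S] in
/-- The power rule `f dTʲ = j f Tʲ⁻¹ dT`, for `T = A 2`. -/
lemma apply_even (hγ : IsCyclicForm γ) (f : FunctionAlgebra S e₁ e₂) (j : ℤ) :
    γ f (A S e₁ e₂ (2 * j)) = j * γ (f * A S e₁ e₂ (2 * (j - 1))) (A S e₁ e₂ (2 * 1)) := by
  have hstep (f : FunctionAlgebra S e₁ e₂) (j : ℤ) : γ f (A S e₁ e₂ (2 * (j + 1))) =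
      γ (f * A S e₁ e₂ (2 * j)) (A S e₁ e₂ (2 * 1))
        + γ (f * A S e₁ e₂ (2 * 1)) (A S e₁ e₂ (2 * j)) := by
    rw [← A_even_mul_even, hγ.leibniz]
  induction j using Int.induction_on generalizing f with
  | zero => rw [mul_zero, A_zero, hγ.one_right]; simp
  | succ j ih =>
    rw [hstep, ih, mul_assoc f, A_even_mul_even, show 1 + ((j : ℤ) - 1) = j by ring,
      add_sub_cancel_right]
    push_cast
    ring
  | pred j ih =>
    have h := hstep (f * A S e₁ e₂ (2 * (-1))) (-(j : ℤ) - 1)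
    rw [sub_add_cancel, ih, mul_assoc f, mul_assoc f, A_even_mul_even,
      A_even_mul_even, show (-1 : ℤ) + 1 = 0 by ring, mul_zero, A_zero,
      mul_one, show (-1 : ℤ) + (-(j : ℤ) - 1) = -(j : ℤ) - 1 - 1 by ring] at h
    rw [mul_one] at h
    push_cast at h ⊢
    linear_combination -h

/-- The residue: the exact differential `dTᵏ` is annihilated, so that `Tⁱ dTʲ` can have a nonzero
value only for `i + j = 0`. -/
lemma apply_even_even (hγ : IsCyclicForm γ) (i j : ℤ) :
    γ (A S e₁ e₂ (2 * i)) (A S e₁ e₂ (2 * j)) =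
      ((2 : ℂ)⁻¹ • γ (A S e₁ e₂ (2 * (-1))) (A S e₁ e₂ (2 * 1))) *
        cycleForm e₁ e₂ (A S e₁ e₂ (2 * i)) (A S e₁ e₂ (2 * j)) := by
  have h2 : algebraMap ℂ S 2⁻¹ * 2 = 1 := by
    rw [← map_ofNat (algebraMap ℂ S) 2, ← map_mul]; simp
  rw [cycleForm_A, cycleValue_even_even, hγ.apply_even, A_even_mul_even]
  split_ifs with hij
  · rw [show i + (j - 1) = -1 by omega, Algebra.smul_def, show j = -i by omega]
    generalize γ (A S e₁ e₂ (2 * (-1))) (A S e₁ e₂ (2 * 1)) = c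
    push_cast
    linear_combination (i * c) * h2
  · have h : γ 1 (A S e₁ e₂ (2 * (i + j))) = 0 := by rw [hγ.skew, hγ.one_right, neg_zero]
    rw [hγ.apply_even, one_mul, add_sub_assoc] at h
    rw [eq_zero_of_intCast_mul hij h, mul_zero, mul_zero]

/-- With `ω = A 1`, the values on the differentials `ω Tⁱ d(ω Tʲ)` are determined by the values on
the differentials of the even functions: `ω dω` is half the differential of `ω²`. -/
lemma apply_odd_odd (hγ : IsCyclicForm γ)
    (h0 : ∀ i j : ℤ, γ (A S e₁ e₂ (2 * i)) (A S e₁ e₂ (2 * j)) = 0) (i j : ℤ) :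
    γ (A S e₁ e₂ (2 * i + 1)) (A S e₁ e₂ (2 * j + 1)) = 0 := by
  have h1 (k : ℤ) : γ (A S e₁ e₂ (2 * k + 1)) (A S e₁ e₂ (2 * 0 + 1)) = 0 := by
    have h := hγ.leibniz (A S e₁ e₂ (2 * k)) (A S e₁ e₂ (2 * 0 + 1)) (A S e₁ e₂ (2 * 0 + 1))
    rw [A_odd_mul_odd, A_even_mul_odd, add_zero] at h
    simp only [map_add, map_smul, h0, smul_zero, add_zero] at h
    generalize γ (A S e₁ e₂ (2 * k + 1)) (A S e₁ e₂ (2 * 0 + 1)) = c at h ⊢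
    refine eq_zero_of_intCast_mul two_ne_zero ?_
    push_cast
    linear_combination -h
  have h := hγ.leibniz (A S e₁ e₂ (2 * i + 1)) (A S e₁ e₂ (2 * 0 + 1)) (A S e₁ e₂ (2 * j))
  rw [A_odd_mul_even, A_odd_mul_odd, A_odd_mul_even, h1, zero_add] at h
  simpa only [map_add, map_smul, LinearMap.add_apply, LinearMap.smul_apply, h0, smul_zero,
    add_zero] using h

/-- The values `d k` on the differentials `ω Tᵏ⁻¹ dT` satisfy the recursion
`(2 i + 3) d (i + 1) + 2 a i d i + (2 i - 3) b d (i - 1) = 0`, where `ω² = T + a + b T⁻¹`: it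
expresses the identity `ω Tⁱ d(ω²) = 2 ω² Tⁱ dω`. The leading coefficient is never zero, so that
vanishing propagates upwards from very negative indices. -/
lemma apply_odd_even (hγ : IsCyclicForm γ)
    (hloc : ∃ K : ℤ, ∀ n m : ℤ, n + m < K → γ (A S e₁ e₂ n) (A S e₁ e₂ m) = 0) (i j : ℤ) :
    γ (A S e₁ e₂ (2 * i + 1)) (A S e₁ e₂ (2 * j)) = 0 := by
  obtain ⟨d, hd⟩ : ∃ d : ℤ → S, ∀ k, d k = γ (A S e₁ e₂ (2 * (k - 1) + 1)) (A S e₁ e₂ (2 * 1)) :=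
    ⟨_, fun _ => rfl⟩
  have hγd (i j : ℤ) : γ (A S e₁ e₂ (2 * i + 1)) (A S e₁ e₂ (2 * j)) = j * d (i + j) := by
    rw [hγ.apply_even, A_odd_mul_even, hd, add_sub_assoc]
  have hγd' (i j : ℤ) : γ (A S e₁ e₂ (2 * j)) (A S e₁ e₂ (2 * i + 1)) = -(j * d (i + j)) := by
    rw [hγ.skew, hγd]
  have hrec (i : ℤ) : ((2 * i + 3 : ℤ) : S) * d (i + 1) = -(2 * (3 * e₁) * i * d i)
      - (2 * i - 3) * ((e₁ - e₂) * (2 * e₁ + e₂)) * d (i - 1) := by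
    have h := hγ.leibniz (A S e₁ e₂ (2 * i + 1)) (A S e₁ e₂ (2 * 0 + 1)) (A S e₁ e₂ (2 * 0 + 1))
    rw [A_odd_mul_odd, A_odd_mul_odd] at h
    simp only [map_add, map_smul, LinearMap.add_apply, LinearMap.smul_apply, hγd, hγd',
      smul_eq_mul, add_zero, zero_add, zero_sub] at h
    rw [show i + -1 = i - 1 by ring] at h
    push_cast at h ⊢
    linear_combination h
  obtain ⟨K, hK⟩ := hloc
  have hlow (k : ℤ) (hk : 2 * k + 1 < K) : d k = 0 := by
    rw [hd]
    exact hK _ _ (by omega)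
  -- Two consecutive zeros of `d` are the induction hypothesis of the three-term recursion.
  have hall (k : ℤ) : d k = 0 ∧ d (k + 1) = 0 := by
    rcases lt_or_ge (2 * k + 3) K with hk | hk
    · exact ⟨hlow _ (by omega), hlow _ (by omega)⟩
    · have hle : (K - 4) / 2 ≤ k := by omega
      induction k, hle using Int.leInduction with
      | base => exact ⟨hlow _ (by omega), hlow _ (by omega)⟩
      | succ k hk' ih =>
        have ih' : d k = 0 ∧ d (k + 1) = 0 := by
          rcases lt_or_ge (2 * k + 3) K with hk | hk
          · exact ⟨hlow _ (by omega), hlow _ (by omega)⟩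
          · exact ih hk
        refine ⟨ih'.2, eq_zero_of_intCast_mul (n := 2 * (k + 1) + 3) (by omega) ?_⟩
        rw [hrec, ih'.2, add_sub_cancel_right, ih'.1]
        simp
  rw [hγd, (hall _).1, mul_zero]

/-- Up to multiples, integration over the separating cycle is the only cyclic form which vanishes
in all sufficiently negative degrees. -/
theorem exists_eq_smul_cycleForm (hγ : IsCyclicForm γ)
    (hloc : ∃ K : ℤ, ∀ n m : ℤ, n + m < K → γ (A S e₁ e₂ n) (A S e₁ e₂ m) = 0) :
    ∃ p : S, γ = p • cycleForm e₁ e₂ := by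
  refine ⟨(2 : ℂ)⁻¹ • γ (A S e₁ e₂ (2 * (-1))) (A S e₁ e₂ (2 * 1)), ?_⟩
  set p : S := (2 : ℂ)⁻¹ • γ (A S e₁ e₂ (2 * (-1))) (A S e₁ e₂ (2 * 1)) with hp
  have hδ := hγ.sub_smul (isCyclicForm_cycleForm (e₁ := e₁) (e₂ := e₂)) p
  have h0 (i j : ℤ) :
      (γ - p • cycleForm e₁ e₂) (A S e₁ e₂ (2 * i)) (A S e₁ e₂ (2 * j)) = 0 := by
    simp only [LinearMap.sub_apply, LinearMap.smul_apply, smul_eq_mul]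
    rw [hγ.apply_even_even, ← hp, sub_self]
  have hloc' : ∃ K : ℤ, ∀ n m : ℤ, n + m < K →
      (γ - p • cycleForm e₁ e₂) (A S e₁ e₂ n) (A S e₁ e₂ m) = 0 := by
    obtain ⟨K, hK⟩ := hloc
    refine ⟨min K 0, fun n m hnm => ?_⟩
    have hz : (cycleValue e₁ e₂ n m : S) = 0 := by
      unfold cycleValue
      split_ifs <;> first | omega | simp
    simp only [LinearMap.sub_apply, LinearMap.smul_apply, cycleForm_A, hz,
      hK n m (by omega), smul_zero, sub_zero]
  rw [← sub_eq_zero]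
  refine (A S e₁ e₂).ext fun n => (A S e₁ e₂).ext fun m => ?_
  obtain ⟨i, rfl | rfl⟩ := Int.even_or_odd' n <;> obtain ⟨j, rfl | rfl⟩ := Int.even_or_odd' m
  · exact h0 i j
  · rw [hδ.skew, hδ.apply_odd_even hloc', neg_zero]; rfl
  · exact hδ.apply_odd_even hloc' i j
  · exact hδ.apply_odd_odd h0 i j

end IsCyclicForm

end CyclicForms

/-! ### Central extensions with a linear section -/

section Gradings

variable {S : Type*} [CommRing S] {M : Type*} [AddCommGroup M] [Module S M]

/-- A family of submodules is a direct sum decomposition if it spans the module and admits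
projections which vanish on the other members of the family. -/
lemma isInternal_of_proj (gr : ℤ → Submodule S M) (π : ℤ → M →ₗ[S] M)
    (hid : ∀ n, ∀ x ∈ gr n, π n x = x) (hzero : ∀ n m, m ≠ n → ∀ x ∈ gr m, π n x = 0)
    (htop : iSup gr = ⊤) : DirectSum.IsInternal gr := by
  refine DirectSum.isInternal_submodule_of_iSupIndep_of_iSup_eq_top (fun n => ?_) htop
  rw [Submodule.disjoint_def]
  intro x hx hx'
  have hle : (⨆ m, ⨆ (_ : m ≠ n), gr m) ≤ LinearMap.ker (π n) :=
    iSup₂_le fun m hm y hy => hzero n m hm y hy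
  rw [← hid n x hx]
  exact hle hx'

lemma exists_proj_of_isInternal {gr : ℤ → Submodule S M} (h : DirectSum.IsInternal gr) :
    ∃ π : ℤ → M →ₗ[S] M, (∀ n, ∀ x ∈ gr n, π n x = x) ∧
      ∀ n m, m ≠ n → ∀ x ∈ gr m, π n x = 0 := by
  have hsymm (m : ℤ) (x : M) (hx : x ∈ gr m) :
      (LinearEquiv.ofBijective (DirectSum.coeLinearMap gr) h).symm x =
        DirectSum.lof S ℤ (fun n => gr n) m ⟨x, hx⟩ := by
    rw [LinearEquiv.symm_apply_eq]
    exact (DirectSum.coeLinearMap_lof _ m ⟨x, hx⟩).symm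
  refine ⟨fun n => (gr n).subtype ∘ₗ DirectSum.component S ℤ (fun n => gr n) n ∘ₗ
    (LinearEquiv.ofBijective (DirectSum.coeLinearMap gr) h).symm.toLinearMap, ?_, ?_⟩
  · intro n x hx
    simp only [LinearMap.comp_apply, LinearEquiv.coe_coe]
    rw [hsymm n x hx, DirectSum.component.lof_self]
    rfl
  · intro n m hm x hx
    simp only [LinearMap.comp_apply, LinearEquiv.coe_coe]
    rw [hsymm m x hx, DirectSum.component.of, dif_neg hm, map_zero]

lemma eq_zero_of_mem_of_mem_iSup {gr : ℤ → Submodule S M} (h : DirectSum.IsInternal gr) {d : ℤ}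
    {I : Set ℤ} (hd : d ∉ I) {x : M} (hx : x ∈ gr d) (hx' : x ∈ ⨆ n ∈ I, gr n) : x = 0 := by
  refine Submodule.disjoint_def.mp (h.submodule_iSupIndep d) x hx ?_
  exact (iSup₂_le fun n hn => le_iSup₂_of_le n (fun hnd => hd (hnd ▸ hn)) le_rfl :
    (⨆ n ∈ I, gr n) ≤ ⨆ m, ⨆ (_ : m ≠ d), gr m) hx'

end Gradings

lemma lie_lie_cyclic {K : Type*} [LieRing K] (x y z : K) :
    ⁅⁅x, y⁆, z⁆ + ⁅⁅y, z⁆, x⁆ + ⁅⁅z, x⁆, y⁆ = 0 := by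
  rw [← neg_eq_zero, ← lie_jacobi x y z, ← lie_skew x ⁅y, z⁆, ← lie_skew y ⁅z, x⁆,
    ← lie_skew z ⁅x, y⁆]
  abel

namespace CentralExtension

variable {S : Type*} [CommRing S] {L : Type*} [LieRing L] [LieAlgebra S L]

/-- A linear section `σ` of a central extension, together with the 2-cocycle `ψ` which measures the
failure of `σ` to be a homomorphism. -/
structure IsSection (C : CentralExtension S L) (σ : L →ₗ[S] C.E) (ψ : LinearMap.BilinForm S L) :
    Prop where
  proj_apply : ∀ x, C.proj (σ x) = x
  lie_apply : ∀ x y, ⁅σ x, σ y⁆ = σ ⁅x, y⁆ + C.incl (ψ x y)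

variable {C : CentralExtension S L}

lemma proj_incl (r : S) : C.proj (C.incl r) = 0 :=
  (C.exact _).mpr ⟨r, rfl⟩

lemma lie_incl (r : S) (x : C.E) : ⁅x, C.incl r⁆ = 0 := by
  rw [← lie_skew, C.central, neg_zero]

lemma lie_add_incl (x y : C.E) (r s : S) : ⁅x + C.incl r, y + C.incl s⁆ = ⁅x, y⁆ := by
  rw [add_lie, lie_add, C.central, lie_incl, add_zero, add_zero]

/-- The linear isomorphism `L × S ≃ E` given by a linear section. -/
def sectionEquiv (C : CentralExtension S L) (σ : L →ₗ[S] C.E) (hσ : ∀ x, C.proj (σ x) = x) :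
    (L × S) ≃ₗ[S] C.E :=
  LinearEquiv.ofBijective (σ.coprod C.incl) <| by
    constructor
    · rw [← LinearMap.ker_eq_bot, LinearMap.ker_eq_bot']
      rintro ⟨x, r⟩ h
      rw [LinearMap.coprod_apply] at h
      have hx : x = 0 := by
        have := congrArg C.proj h
        rwa [map_add, hσ, proj_incl, add_zero, map_zero] at this
      subst hx
      rw [map_zero, zero_add] at h
      exact Prod.ext rfl (C.incl_injective (h.trans (map_zero _).symm))
    · intro u
      have h : C.proj (u - σ (C.proj u)) = 0 := by rw [map_sub, hσ, sub_self]
      obtain ⟨r, hr⟩ := (C.exact _).mp h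
      exact ⟨(C.proj u, r), by rw [LinearMap.coprod_apply, hr, add_sub_cancel]⟩

lemma sectionEquiv_apply (σ : L →ₗ[S] C.E) (hσ : ∀ x, C.proj (σ x) = x) (x : L) (r : S) :
    C.sectionEquiv σ hσ (x, r) = σ x + C.incl r := rfl

lemma exists_isSection (σ : L →ₗ[S] C.E) (hσ : ∀ x, C.proj (σ x) = x) :
    ∃ ψ : LinearMap.BilinForm S L, C.IsSection σ ψ := by
  refine ⟨LinearMap.mk₂ S (fun x y => ((C.sectionEquiv σ hσ).symm ⁅σ x, σ y⁆).2)
    (fun _ _ _ => by simp) (fun _ _ _ => by simp) (fun _ _ _ => by simp) (fun _ _ _ => by simp),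
    hσ, fun x y => ?_⟩
  obtain ⟨⟨z, r⟩, hzr⟩ := (C.sectionEquiv σ hσ).surjective ⁅σ x, σ y⁆
  rw [LinearMap.mk₂_apply, ← hzr, LinearEquiv.symm_apply_apply]
  have hz : z = ⁅x, y⁆ := by
    have h := congrArg C.proj hzr
    rwa [sectionEquiv_apply, map_add, hσ, proj_incl, add_zero, LieHom.map_lie, hσ, hσ] at h
  rw [sectionEquiv_apply, hz]

namespace IsSection

variable {σ : L →ₗ[S] C.E} {ψ : LinearMap.BilinForm S L}

lemma skew (h : C.IsSection σ ψ) (x y : L) : ψ x y = -ψ y x := by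
  have h1 := h.lie_apply y x
  rw [← lie_skew, h.lie_apply, ← lie_skew y x, map_neg, neg_add, add_right_inj, ← map_neg] at h1
  rw [← neg_eq_iff_eq_neg]
  exact C.incl_injective h1

/-- The Jacobi identity of the extended algebra. -/
lemma cocycle (h : C.IsSection σ ψ) (x y z : L) : ψ ⁅x, y⁆ z + ψ ⁅y, z⁆ x + ψ ⁅z, x⁆ y = 0 := by
  have h1 (x y z : L) : ⁅⁅σ x, σ y⁆, σ z⁆ = σ ⁅⁅x, y⁆, z⁆ + C.incl (ψ ⁅x, y⁆ z) := by
    rw [h.lie_apply, add_lie, C.central, add_zero, h.lie_apply]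
  have h3 := lie_lie_cyclic (σ x) (σ y) (σ z)
  rw [h1, h1, h1] at h3
  apply C.incl_injective
  have h4 := congrArg σ (lie_lie_cyclic x y z)
  rw [map_add, map_add, map_zero] at h4
  rw [map_add, map_add, map_zero, ← h3, ← sub_eq_zero]
  rw [← neg_eq_zero, ← h4]
  abel

/-- Changing the section changes the cocycle by a coboundary. -/
lemma sub_coboundary (h : C.IsSection σ ψ) (φ : L →ₗ[S] S) {ψ' : LinearMap.BilinForm S L}
    (hψ' : ∀ x y, ψ' x y = ψ x y - φ ⁅x, y⁆) : C.IsSection (σ + C.incl ∘ₗ φ) ψ' where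
  proj_apply x := by
    rw [LinearMap.add_apply, LinearMap.comp_apply, map_add, proj_incl, add_zero, h.proj_apply]
  lie_apply x y := by
    simp only [LinearMap.add_apply, LinearMap.comp_apply]
    rw [lie_add_incl, h.lie_apply, hψ', map_sub]
    abel

/-- Extensions with sections of the same cocycle are equivalent. -/
lemma equivalent (h : C.IsSection σ ψ) {D : CentralExtension S L} {τ : L →ₗ[S] D.E}
    (h' : D.IsSection τ ψ) : C.Equivalent D := by
  set e := C.sectionEquiv σ h.proj_apply with he
  set f := D.sectionEquiv τ h'.proj_apply with hf
  have hef (x : L) (r : S) : (e.symm ≪≫ₗ f) (σ x + C.incl r) = τ x + D.incl r := by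
    rw [LinearEquiv.trans_apply, ← sectionEquiv_apply σ h.proj_apply x r, ← he,
      LinearEquiv.symm_apply_apply]
    rfl
  have hsurj (u : C.E) : ∃ x r, u = σ x + C.incl r := by
    obtain ⟨⟨x, r⟩, hxr⟩ := e.surjective u
    exact ⟨x, r, hxr.symm⟩
  refine ⟨{ e.symm ≪≫ₗ f with
    map_lie' := ?_ }, fun r => ?_, fun u => ?_⟩
  · intro u v
    obtain ⟨x, r, rfl⟩ := hsurj u
    obtain ⟨y, s, rfl⟩ := hsurj v
    change (e.symm ≪≫ₗ f) _ = ⁅(e.symm ≪≫ₗ f) _, (e.symm ≪≫ₗ f) _⁆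
    rw [hef, hef, lie_add_incl, lie_add_incl, h.lie_apply, h'.lie_apply, hef]
  · change (e.symm ≪≫ₗ f) _ = _
    have := hef 0 r
    rwa [map_zero, map_zero, zero_add, zero_add] at this
  · change D.proj ((e.symm ≪≫ₗ f) u) = _
    obtain ⟨x, r, rfl⟩ := hsurj u
    rw [hef, map_add, map_add, proj_incl, proj_incl, h.proj_apply, h'.proj_apply]

/-- On commuting elements the cocycle does not depend on the section, since it is the bracket of
any lifts. -/
lemma incl_apply_of_equivalent {D : CentralExtension S L} {τ : L →ₗ[S] D.E}
    (h : D.IsSection τ ψ) (hCD : C.Equivalent D) {x y : L} (hxy : ⁅x, y⁆ = 0) {u v : C.E}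
    (hu : C.proj u = x) (hv : C.proj v = y) : C.incl (ψ x y) = ⁅u, v⁆ := by
  obtain ⟨φ, hincl, hproj⟩ := hCD
  have hlift (w : C.E) : ∃ r, φ w = τ (C.proj w) + D.incl r := by
    obtain ⟨r, hr⟩ := (D.exact (φ w - τ (C.proj w))).mp
      (by rw [map_sub, hproj, h.proj_apply, sub_self])
    exact ⟨r, by rw [hr, add_sub_cancel]⟩
  obtain ⟨r, hr⟩ := hlift u
  obtain ⟨s, hs⟩ := hlift v
  apply φ.injective
  change φ _ = φ _
  rw [hincl, LieEquiv.map_lie, hr, hs, lie_add_incl, h.lie_apply, hu, hv, hxy, map_zero, zero_add]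

/-- If the cocycle vanishes outside a strip of degrees, the central element may be given the degree
`0`. -/
lemma isAlmostGraded (h : C.IsSection σ ψ) {gr : ℤ → Submodule S L} (hgr : IsAlmostGrading S gr)
    (hloc : ∃ r s : ℤ, ∀ n m, ∀ x ∈ gr n, ∀ y ∈ gr m, n + m ∉ Set.Icc r s → ψ x y = 0) :
    C.IsAlmostGraded gr := by
  obtain ⟨hint, hfin, r, s, hrs⟩ := hgr
  obtain ⟨r', s', hrs'⟩ := hloc
  set e := C.sectionEquiv σ h.proj_apply with he
  let z : ℤ → Submodule S S := fun n => if n = 0 then ⊤ else ⊥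
  let grE : ℤ → Submodule S C.E := fun n => ((gr n).prod (z n)).map e.toLinearMap
  have hmem (n : ℤ) (u : C.E) : u ∈ grE n ↔ ∃ x ∈ gr n, ∃ c ∈ z n, u = σ x + C.incl c := by
    constructor
    · rintro ⟨⟨x, c⟩, ⟨hx, hc⟩, rfl⟩
      exact ⟨x, hx, c, hc, rfl⟩
    · rintro ⟨x, hx, c, hc, rfl⟩
      exact ⟨(x, c), ⟨hx, hc⟩, rfl⟩
  have hσmem (n : ℤ) {x : L} (hx : x ∈ gr n) : σ x ∈ grE n :=
    (hmem _ _).mpr ⟨x, hx, 0, Submodule.zero_mem _, by rw [map_zero, add_zero]⟩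
  have hincl (c : S) : C.incl c ∈ grE 0 :=
    (hmem _ _).mpr ⟨0, Submodule.zero_mem _, c, by simp [z], by rw [map_zero, zero_add]⟩
  have hσsup (I : Set ℤ) {x : L} (hx : x ∈ ⨆ n ∈ I, gr n) : σ x ∈ ⨆ n ∈ I, grE n := by
    have hle : (⨆ n ∈ I, gr n) ≤ (⨆ n ∈ I, grE n).comap σ :=
      iSup₂_le fun n hn y hy => Submodule.mem_iSup_of_mem n
        (Submodule.mem_iSup_of_mem hn (hσmem n hy))
    exact hle hx
  obtain ⟨π, hid, hzero⟩ := exists_proj_of_isInternal hint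
  refine ⟨grE, ⟨?_, fun n => ?_, min r (-s'), max s (-r'), fun n m u hu v hv => ?_⟩,
    fun n => ?_, 0, hincl 1⟩
  -- The projections of `gr` and of `S`, placed in degree `0`, are transported to the extension.
  · let ε : ℤ → S →ₗ[S] S := fun n => if n = 0 then LinearMap.id else 0
    have hE (n : ℤ) (x : L) (c : S) :
        (e.toLinearMap ∘ₗ (π n).prodMap (ε n) ∘ₗ e.symm.toLinearMap) (σ x + C.incl c) =
          σ (π n x) + C.incl (ε n c) := by
      rw [← sectionEquiv_apply σ h.proj_apply x c, ← he]
      simp only [LinearMap.comp_apply, LinearEquiv.coe_coe, LinearEquiv.symm_apply_apply]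
      rfl
    refine isInternal_of_proj grE
      (fun n => e.toLinearMap ∘ₗ (π n).prodMap (ε n) ∘ₗ e.symm.toLinearMap) ?_ ?_ ?_
    · intro n u hu
      obtain ⟨x, hx, c, hc, rfl⟩ := (hmem _ _).mp hu
      rw [hE, hid n x hx]
      by_cases hn : n = 0
      · simp [ε, hn]
      · have hc' : c = 0 := by simpa [z, hn] using hc
        simp [hc']
    · intro n m hmn u hu
      obtain ⟨x, hx, c, hc, rfl⟩ := (hmem _ _).mp hu
      rw [hE, hzero n m hmn x hx, map_zero, zero_add]
      by_cases hm : m = 0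
      · simp [ε, show n ≠ 0 by omega]
      · have hc' : c = 0 := by simpa [z, hm] using hc
        simp [hc']
    · rw [eq_top_iff]
      rintro u -
      obtain ⟨⟨x, c⟩, rfl⟩ := e.surjective u
      refine Submodule.add_mem _ ?_ (Submodule.mem_iSup_of_mem 0 (hincl c))
      have hle : iSup gr ≤ (iSup grE).comap σ :=
        iSup_le fun n y hy => Submodule.mem_iSup_of_mem n (hσmem n hy)
      exact hle (by rw [hint.submodule_iSup_eq_top]; trivial)
  · rw [Module.Finite.iff_fg]
    refine Submodule.FG.map _ (Submodule.FG.prod (Module.Finite.iff_fg.mp (hfin n)) ?_)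
    by_cases hn : n = 0
    · simpa [z, hn] using Module.Finite.fg_top (R := S) (M := S)
    · simpa [z, hn] using Submodule.fg_bot
  · obtain ⟨x, hx, c, hc, rfl⟩ := (hmem _ _).mp hu
    obtain ⟨y, hy, d, hd, rfl⟩ := (hmem _ _).mp hv
    rw [lie_add_incl, h.lie_apply]
    refine Submodule.add_mem _ ?_ ?_
    · have hmono : (⨆ k ∈ Set.Icc (n + m + r) (n + m + s), grE k) ≤
          ⨆ k ∈ Set.Icc (n + m + min r (-s')) (n + m + max s (-r')), grE k :=
        biSup_mono fun k hk => ⟨by have := hk.1; omega, by have := hk.2; omega⟩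
      exact hmono (hσsup _ (hrs n m x hx y hy))
    · by_cases hnm : n + m ∈ Set.Icc r' s'
      · have := hnm.1
        have := hnm.2
        exact Submodule.mem_iSup_of_mem 0 (Submodule.mem_iSup_of_mem
          ⟨by omega, by omega⟩ (hincl _))
      · rw [hrs' n m x hx y hy hnm, map_zero]
        exact Submodule.zero_mem _
  · ext x
    constructor
    · rintro ⟨u, hu, rfl⟩
      obtain ⟨y, hy, c, hc, rfl⟩ := (hmem _ _).mp hu
      change C.proj _ ∈ _
      rwa [map_add, proj_incl, h.proj_apply, add_zero]
    · intro hx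
      exact ⟨σ x, hσmem n hx, h.proj_apply x⟩

end IsSection

end CentralExtension

/-! ### The grading of the current algebra and the geometric extensions -/

section CurrentAlgebraGrading

variable {S : Type*} [CommRing S] [Algebra ℂ S] {e₁ e₂ : S}
variable {g : Type*} [LieRing g] [LieAlgebra ℂ g]

namespace CurrentAlgebra

lemma add_tmul (f f' : FunctionAlgebra S e₁ e₂) (x : g) :
    tmul (f + f') x = tmul f x + tmul f' x := TensorProduct.add_tmul _ _ _

lemma tmul_add (f : FunctionAlgebra S e₁ e₂) (x x' : g) :
    tmul f (x + x') = tmul f x + tmul f x' := TensorProduct.tmul_add _ _ _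

lemma smul_tmul (s : S) (f : FunctionAlgebra S e₁ e₂) (x : g) :
    tmul (s • f) x = s • tmul f x := rfl

lemma tmul_smul (c : ℂ) (f : FunctionAlgebra S e₁ e₂) (x : g) :
    tmul f (c • x) = algebraMap ℂ S c • tmul f x := by
  rw [← smul_tmul, algebraMap_smul]
  exact (TensorProduct.smul_tmul c f x).symm

lemma tmul_neg (f : FunctionAlgebra S e₁ e₂) (x : g) : tmul f (-x) = -tmul f x := by
  rw [← neg_one_smul ℂ x, tmul_smul, map_neg, map_one, neg_one_smul]

lemma tmul_zero (f : FunctionAlgebra S e₁ e₂) : tmul f (0 : g) = 0 := TensorProduct.tmul_zero _ _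

end CurrentAlgebra

open CurrentAlgebra

lemma tmul_mem_homogeneousPart (n : ℤ) (x : g) :
    tmul (A S e₁ e₂ n) x ∈ homogeneousPart S e₁ e₂ g n :=
  Submodule.subset_span ⟨x, rfl⟩

lemma iSup_homogeneousPart : iSup (homogeneousPart S e₁ e₂ g) = ⊤ := by
  rw [eq_top_iff]
  rintro u -
  induction u using CurrentAlgebra.induction with
  | h f x =>
    induction f using A_induction with
    | hA n => exact Submodule.mem_iSup_of_mem n (tmul_mem_homogeneousPart n x)
    | hadd f f' h h' => rw [add_tmul]; exact Submodule.add_mem _ h h'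
    | hsmul c f h => rw [smul_tmul]; exact Submodule.smul_mem _ c h
  | hadd u v hu hv => exact Submodule.add_mem _ hu hv

/-- An `S`-linear map on the current algebra, given by its `ℂ`-linear components on the
homogeneous parts `A n ⊗ g`. -/
def ofComponents {M : Type*} [AddCommGroup M] [Module S M] [Module ℂ M] [IsScalarTower ℂ S M]
    (φ : ℤ → g →ₗ[ℂ] M) : CurrentAlgebra S e₁ e₂ g →ₗ[S] M :=
  (TensorProduct.AlgebraTensorModule.lift ((A S e₁ e₂).constr S φ) :
    FunctionAlgebra S e₁ e₂ ⊗[ℂ] g →ₗ[S] M)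

lemma ofComponents_tmul {M : Type*} [AddCommGroup M] [Module S M] [Module ℂ M]
    [IsScalarTower ℂ S M] (φ : ℤ → g →ₗ[ℂ] M) (n : ℤ) (x : g) :
    ofComponents φ (tmul (A S e₁ e₂ n) x) = φ n x :=
  congr($((A S e₁ e₂).constr_basis S φ n) x)

/-- The projection to the homogeneous part of degree `n`. -/
def degreeProj (n : ℤ) : CurrentAlgebra S e₁ e₂ g →ₗ[S] CurrentAlgebra S e₁ e₂ g :=
  (TensorProduct.AlgebraTensorModule.map
    ((A S e₁ e₂).constr S fun m => if m = n then A S e₁ e₂ m else 0) LinearMap.id :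
    FunctionAlgebra S e₁ e₂ ⊗[ℂ] g →ₗ[S] FunctionAlgebra S e₁ e₂ ⊗[ℂ] g)

lemma degreeProj_tmul (n m : ℤ) (x : g) : degreeProj n (tmul (A S e₁ e₂ m) x) =
    tmul (if m = n then A S e₁ e₂ m else 0) x :=
  congrArg (fun f => tmul f x) ((A S e₁ e₂).constr_basis S _ m)

lemma isInternal_homogeneousPart : DirectSum.IsInternal (homogeneousPart S e₁ e₂ g) := by
  refine isInternal_of_proj _ degreeProj (fun n x hx => ?_) (fun n m hmn x hx => ?_)
    iSup_homogeneousPart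
  · have hle : homogeneousPart S e₁ e₂ g n ≤ LinearMap.eqLocus (degreeProj n) LinearMap.id := by
      refine Submodule.span_le.mpr ?_
      rintro _ ⟨x, rfl⟩
      rw [SetLike.mem_coe, LinearMap.mem_eqLocus, degreeProj_tmul, if_pos rfl, LinearMap.id_apply]
    exact hle hx
  · have hle : homogeneousPart S e₁ e₂ g m ≤ LinearMap.ker (degreeProj n) := by
      refine Submodule.span_le.mpr ?_
      rintro _ ⟨x, rfl⟩
      rw [SetLike.mem_coe, LinearMap.mem_ker, degreeProj_tmul, if_neg hmn]
      exact TensorProduct.zero_tmul _ _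
    exact hle hx

lemma tmul_mem_of_basis {ι : Type*} (b : Module.Basis ι ℂ g) (f : FunctionAlgebra S e₁ e₂)
    {N : Submodule S (CurrentAlgebra S e₁ e₂ g)} (h : ∀ i, tmul f (b i) ∈ N) (x : g) :
    tmul f x ∈ N := by
  have hx := b.mem_span x
  induction hx using Submodule.span_induction with
  | mem x hx => obtain ⟨i, rfl⟩ := hx; exact h i
  | zero => rw [tmul_zero]; exact Submodule.zero_mem _
  | add x y _ _ hx hy => rw [tmul_add]; exact Submodule.add_mem _ hx hy
  | smul c x _ hx => rw [tmul_smul]; exact Submodule.smul_mem _ _ hx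

lemma homogeneousPart_eq_span_basis {ι : Type*} (b : Module.Basis ι ℂ g) (n : ℤ) :
    homogeneousPart S e₁ e₂ g n =
      Submodule.span S (Set.range fun i => tmul (A S e₁ e₂ n) (b i)) := by
  refine le_antisymm (Submodule.span_le.mpr ?_) (Submodule.span_mono ?_)
  · rintro _ ⟨x, rfl⟩
    exact tmul_mem_of_basis b _ (fun i => Submodule.subset_span (Set.mem_range_self i)) x
  · rintro _ ⟨i, rfl⟩
    exact ⟨b i, rfl⟩

/-- The bracket lowers the degree by at most `4`. -/
lemma lie_mem_of_homogeneousPart (N : Submodule S (CurrentAlgebra S e₁ e₂ g)) {n m : ℤ}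
    (hN : ∀ k, n + m - 4 ≤ k → k ≤ n + m → homogeneousPart S e₁ e₂ g k ≤ N)
    {u v : CurrentAlgebra S e₁ e₂ g} (hu : u ∈ homogeneousPart S e₁ e₂ g n)
    (hv : v ∈ homogeneousPart S e₁ e₂ g m) : ⁅u, v⁆ ∈ N := by
  have h (k : ℤ) (h1 : n + m - 4 ≤ k) (h2 : k ≤ n + m) (x : g) : tmul (A S e₁ e₂ k) x ∈ N :=
    hN k h1 h2 (tmul_mem_homogeneousPart k x)
  induction hu using Submodule.span_induction with
  | mem u hu =>
    obtain ⟨x, rfl⟩ := hu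
    induction hv using Submodule.span_induction with
    | mem v hv =>
      obtain ⟨y, rfl⟩ := hv
      simp only [lie_tmul, A_mul_A]
      split_ifs
      · rw [add_tmul, add_tmul, smul_tmul, smul_tmul]
        exact N.add_mem (N.add_mem (h _ (by omega) (by omega) _)
          (N.smul_mem _ (h _ (by omega) (by omega) _)))
          (N.smul_mem _ (h _ (by omega) (by omega) _))
      · exact h _ (by omega) (by omega) _
    | zero => rw [lie_zero]; exact N.zero_mem
    | add v v' _ _ hv hv' => rw [lie_add]; exact N.add_mem hv hv'
    | smul c v _ hv => rw [lie_smul]; exact N.smul_mem c hv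
  | zero => rw [zero_lie]; exact N.zero_mem
  | add u u' _ _ hu hu' => rw [add_lie]; exact N.add_mem hu hu'
  | smul c u _ hu => rw [smul_lie]; exact N.smul_mem c hu

lemma isAlmostGrading_homogeneousPart [FiniteDimensional ℂ g] :
    IsAlmostGrading S (homogeneousPart S e₁ e₂ g) := by
  refine ⟨isInternal_homogeneousPart, fun n => ?_, -4, 0, fun n m u hu v hv => ?_⟩
  · rw [homogeneousPart_eq_span_basis (Module.finBasis ℂ g)]
    exact Module.Finite.span_of_finite S (Set.finite_range _)
  · refine lie_mem_of_homogeneousPart _ (fun k h1 h2 => ?_) hu hv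
    exact le_iSup₂_of_le (f := fun h (_ : h ∈ Set.Icc (n + m + -4) (n + m + 0)) =>
      homogeneousPart S e₁ e₂ g h) k ⟨by omega, by omega⟩ le_rfl

lemma apply_eq_zero_of_homogeneousPart (ψ : LinearMap.BilinForm S (CurrentAlgebra S e₁ e₂ g))
    {n m : ℤ} (h : ∀ x y : g, ψ (tmul (A S e₁ e₂ n) x) (tmul (A S e₁ e₂ m) y) = 0)
    {u v : CurrentAlgebra S e₁ e₂ g} (hu : u ∈ homogeneousPart S e₁ e₂ g n)
    (hv : v ∈ homogeneousPart S e₁ e₂ g m) : ψ u v = 0 := by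
  have hle : homogeneousPart S e₁ e₂ g n ≤ LinearMap.ker (ψ.flip v) := by
    refine Submodule.span_le.mpr ?_
    rintro _ ⟨x, rfl⟩
    have hle' : homogeneousPart S e₁ e₂ g m ≤ LinearMap.ker (ψ (tmul (A S e₁ e₂ n) x)) := by
      refine Submodule.span_le.mpr ?_
      rintro _ ⟨y, rfl⟩
      exact h x y
    exact hle' hv
  exact hle hu

end CurrentAlgebraGrading

section KillingExtension

variable {S : Type*} [CommRing S] [Algebra ℂ S] {e₁ e₂ : S}
variable {g : Type*} [LieRing g] [LieAlgebra ℂ g]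

open CurrentAlgebra

lemma isSection_killingExtension (p : S) :
    ∃ σ, (killingExtension e₁ e₂ g p).IsSection σ (affineForm e₁ e₂ (killingForm ℂ g) p) := by
  let ψ := affineCocycle e₁ e₂ (killingForm ℂ g) (LieModule.traceForm_comm ℂ g g)
    (LieModule.traceForm_apply_lie_apply ℂ g g) p
  refine ⟨{ toFun := fun x => (LieAlgebra.ofProd ψ (x, 0) : LieAlgebra.ofTwoCocycle ψ)
            map_add' := fun x y => ?_
            map_smul' := fun c x => ?_ }, fun x => rfl, fun x y => ?_⟩
  · rw [← add_zero (0 : TrivialLieModule S (CurrentAlgebra S e₁ e₂ g) S), ← Prod.mk_add_mk,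
      LieAlgebra.of_add, add_zero]
    rfl
  · rw [← smul_zero c, ← Prod.smul_mk, LieAlgebra.of_smul, smul_zero]
    rfl
  · change (⁅LieAlgebra.ofProd ψ (x, 0), LieAlgebra.ofProd ψ (y, 0)⁆ : LieAlgebra.ofTwoCocycle ψ) =
      LieAlgebra.ofProd ψ (⁅x, y⁆, 0) + LieAlgebra.ofProd ψ (0,
        (TrivialLieModule.equiv S (CurrentAlgebra S e₁ e₂ g) S).symm
          (affineForm e₁ e₂ (killingForm ℂ g) p x y))
    rw [LieAlgebra.bracket_ofTwoCocycle, ← LieAlgebra.of_add]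
    simp only [Equiv.symm_apply_apply, lie_zero, add_zero, sub_zero, Prod.mk_add_mk, zero_add]
    rfl

omit [Algebra ℂ S] in
lemma cycleValue_eq_zero (n m : ℤ) (h : n + m ∉ Set.Icc (0 : ℤ) 4) :
    (cycleValue e₁ e₂ n m : S) = 0 := by
  rw [Set.mem_Icc] at h
  unfold cycleValue
  split_ifs <;> first | omega | simp

theorem killingExtension_isAlmostGraded [FiniteDimensional ℂ g] (p : S) :
    (killingExtension e₁ e₂ g p).IsAlmostGraded (homogeneousPart S e₁ e₂ g) := by
  obtain ⟨σ, hσ⟩ := isSection_killingExtension (g := g) (e₁ := e₁) (e₂ := e₂) p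
  refine hσ.isAlmostGraded isAlmostGrading_homogeneousPart
    ⟨0, 4, fun n m u hu v hv hnm => apply_eq_zero_of_homogeneousPart _ (fun x y => ?_) hu hv⟩
  rw [affineForm_tmul, cycleForm_A, cycleValue_eq_zero n m hnm, smul_zero, mul_zero]

variable [FiniteDimensional ℂ g] [LieAlgebra.IsSimple ℂ g]

/-- The parameter `p` is read off from the bracket of commuting elements `A 2 ⊗ x` and
`A (-2) ⊗ x`. -/
theorem killingExtension_param_unique
    {C : CentralExtension S (CurrentAlgebra S e₁ e₂ g)} {p p' : S}
    (h : C.Equivalent (killingExtension e₁ e₂ g p))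
    (h' : C.Equivalent (killingExtension e₁ e₂ g p')) : p = p' := by
  obtain ⟨x, hx⟩ := exists_killingForm_self_ne_zero g
  obtain ⟨σ, hσ⟩ := isSection_killingExtension (g := g) (e₁ := e₁) (e₂ := e₂) p
  obtain ⟨σ', hσ'⟩ := isSection_killingExtension (g := g) (e₁ := e₁) (e₂ := e₂) p'
  have hcomm : ⁅tmul (A S e₁ e₂ 2) x, tmul (A S e₁ e₂ (-2)) x⁆ = 0 := by
    rw [lie_tmul, lie_self, tmul_zero]
  obtain ⟨u, hu⟩ := C.proj_surjective (tmul (A S e₁ e₂ 2) x)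
  obtain ⟨v, hv⟩ := C.proj_surjective (tmul (A S e₁ e₂ (-2)) x)
  have heq := C.incl_injective ((hσ.incl_apply_of_equivalent h hcomm hu hv).trans
    (hσ'.incl_apply_of_equivalent h' hcomm hu hv).symm)
  have hval : (cycleValue e₁ e₂ 2 (-2) : S) = ((-2 : ℤ) : S) := by
    rw [cycleValue, if_pos (by decide), if_pos rfl]
    push_cast
    rfl
  rw [affineForm_tmul, affineForm_tmul, cycleForm_A, hval, mul_smul_comm, mul_smul_comm,
    ← sub_eq_zero, ← smul_sub, smul_eq_zero, or_iff_right hx, ← sub_mul, mul_comm] at heq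
  exact sub_eq_zero.mp (eq_zero_of_intCast_mul (by norm_num) heq)

end KillingExtension

/-! ### Classification of the almost-graded extensions -/

section Classification

variable {S : Type*} [CommRing S] [Algebra ℂ S] {e₁ e₂ : S}
variable {g : Type*} [LieRing g] [LieAlgebra ℂ g]

open CurrentAlgebra

/-- The grading of the extension is used to choose a section which is compatible with the degrees;
its cocycle is then local. Only the bound from below is recorded. -/
lemma exists_local_isSection [FiniteDimensional ℂ g]
    {C : CentralExtension S (CurrentAlgebra S e₁ e₂ g)}
    (hC : C.IsAlmostGraded (homogeneousPart S e₁ e₂ g)) :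
    ∃ σ ψ, C.IsSection σ ψ ∧ ∃ K : ℤ, ∀ n m : ℤ, n + m < K → ∀ x y : g,
      ψ (tmul (A S e₁ e₂ n) x) (tmul (A S e₁ e₂ m) y) = 0 := by
  obtain ⟨grE, ⟨hint, -, r, s, hrs⟩, hmap, d, hd⟩ := hC
  let b := Module.finBasis ℂ g
  let B : Module.Basis (ℤ × Fin (Module.finrank ℂ g)) S (CurrentAlgebra S e₁ e₂ g) :=
    ((A S e₁ e₂).tensorProduct b :
      Module.Basis _ S (FunctionAlgebra S e₁ e₂ ⊗[ℂ] g))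
  have hB (k) : B k = tmul (A S e₁ e₂ k.1) (b k.2) :=
    (A S e₁ e₂).tensorProduct_apply' b k
  have hlift (k : ℤ × Fin (Module.finrank ℂ g)) : ∃ w ∈ grE k.1, C.proj w = B k := by
    have h : B k ∈ (grE k.1).map (C.proj : C.E →ₗ[S] CurrentAlgebra S e₁ e₂ g) := by
      rw [hmap, hB]
      exact tmul_mem_homogeneousPart _ _
    exact h
  choose w hw hproj using hlift
  let σ : CurrentAlgebra S e₁ e₂ g →ₗ[S] C.E := B.constr S w
  have hσB (k) : σ (B k) = w k := B.constr_basis S w k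
  have hσ (x : CurrentAlgebra S e₁ e₂ g) : C.proj (σ x) = x := by
    have h : (C.proj : C.E →ₗ[S] CurrentAlgebra S e₁ e₂ g) ∘ₗ σ = LinearMap.id := by
      refine B.ext fun k => ?_
      change C.proj (σ (B k)) = B k
      rw [hσB, hproj]
    exact congr($h x)
  have hσmem (n : ℤ) : homogeneousPart S e₁ e₂ g n ≤ (grE n).comap σ := by
    rw [homogeneousPart_eq_span_basis b, Submodule.span_le]
    rintro _ ⟨i, rfl⟩
    have h := hw (n, i)
    rw [← hσB, hB] at h
    exact h
  obtain ⟨ψ, hψ⟩ := C.exists_isSection σ hσ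
  -- Below this bound both `⁅σ u, σ v⁆` and `σ ⁅u, v⁆` lie in degrees less than that of `t`.
  refine ⟨σ, ψ, hψ, min d (d - s), fun n m hnm x y => ?_⟩
  set u := tmul (A S e₁ e₂ n) x with hu
  set v := tmul (A S e₁ e₂ m) y with hv
  have humem := tmul_mem_homogeneousPart (S := S) (e₁ := e₁) (e₂ := e₂) n x
  have hvmem := tmul_mem_homogeneousPart (S := S) (e₁ := e₁) (e₂ := e₂) m y
  have h1 : ⁅σ u, σ v⁆ ∈ ⨆ k ∈ Set.Iio d, grE k := by
    have hmono : (⨆ k ∈ Set.Icc (n + m + r) (n + m + s), grE k) ≤ ⨆ k ∈ Set.Iio d, grE k :=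
      biSup_mono fun k hk => by
        have := hk.2
        exact Set.mem_Iio.mpr (by omega)
    exact hmono (hrs n m _ (hσmem n humem) _ (hσmem m hvmem))
  have h2 : σ ⁅u, v⁆ ∈ ⨆ k ∈ Set.Iio d, grE k := by
    refine lie_mem_of_homogeneousPart ((⨆ k ∈ Set.Iio d, grE k).comap σ)
      (fun k _ hk => (hσmem k).trans (Submodule.comap_mono ?_)) humem hvmem
    exact le_iSup₂_of_le (f := fun h (_ : h ∈ Set.Iio d) => grE h) k
      (Set.mem_Iio.mpr (by omega)) le_rfl
  have h3 : C.incl (ψ u v) ∈ ⨆ k ∈ Set.Iio d, grE k := by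
    have := Submodule.sub_mem _ h1 h2
    rwa [hψ.lie_apply, add_sub_cancel_left] at this
  have h4 : C.incl (ψ u v) ∈ grE d := by
    rw [← mul_one (ψ u v), ← smul_eq_mul, map_smul]
    exact Submodule.smul_mem _ _ hd
  exact C.incl_injective
    ((eq_zero_of_mem_of_mem_iSup hint (Set.self_notMem_Iio) h4 h3).trans (map_zero _).symm)

/-- The component `(x, y) ↦ ψ (f ⊗ x) (h ⊗ y)` of a bilinear form on the current algebra. -/
def formComponent (ψ : LinearMap.BilinForm S (CurrentAlgebra S e₁ e₂ g))
    (f h : FunctionAlgebra S e₁ e₂) : g →ₗ[ℂ] g →ₗ[ℂ] S :=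
  LinearMap.mk₂ ℂ (fun x y => ψ (tmul f x) (tmul h y))
    (fun _ _ _ => by simp [tmul_add]) (fun _ _ _ => by simp [tmul_smul, Algebra.smul_def])
    (fun _ _ _ => by simp [tmul_add]) (fun _ _ _ => by simp [tmul_smul, Algebra.smul_def])

lemma formComponent_apply (ψ : LinearMap.BilinForm S (CurrentAlgebra S e₁ e₂ g))
    (f h : FunctionAlgebra S e₁ e₂) (x y : g) :
    formComponent ψ f h x y = ψ (tmul f x) (tmul h y) := rfl

variable [FiniteDimensional ℂ g] [LieAlgebra.IsSimple ℂ g]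

/-- A cocycle can be changed by a coboundary, preserving locality, so that `1 ⊗ g` pairs trivially
with everything: for fixed `f` the pairing of `1 ⊗ x` with `f ⊗ y` is a 1-cocycle of `g` with values
in its dual. -/
lemma exists_normalized_isSection {C : CentralExtension S (CurrentAlgebra S e₁ e₂ g)}
    {σ : CurrentAlgebra S e₁ e₂ g →ₗ[S] C.E}
    {ψ : LinearMap.BilinForm S (CurrentAlgebra S e₁ e₂ g)} (hψ : C.IsSection σ ψ)
    {K : ℤ} (hK : ∀ n m : ℤ, n + m < K → ∀ x y : g,
      ψ (tmul (A S e₁ e₂ n) x) (tmul (A S e₁ e₂ m) y) = 0) :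
    ∃ σ' ψ', C.IsSection σ' ψ' ∧
      (∀ n m : ℤ, n + m < K → ∀ x y : g,
        ψ' (tmul (A S e₁ e₂ n) x) (tmul (A S e₁ e₂ m) y) = 0) ∧
      ∀ (x : g) (f : FunctionAlgebra S e₁ e₂) (y : g), ψ' (tmul 1 x) (tmul f y) = 0 := by
  have hcoc (f : FunctionAlgebra S e₁ e₂) (x y z : g) : formComponent ψ 1 f ⁅x, y⁆ z =
      formComponent ψ 1 f x ⁅y, z⁆ - formComponent ψ 1 f y ⁅x, z⁆ := by
    have h := hψ.cocycle (tmul 1 x) (tmul 1 y) (tmul f z)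
    simp only [lie_tmul, one_mul, mul_one] at h
    rw [hψ.skew (tmul f ⁅y, z⁆), hψ.skew (tmul f ⁅z, x⁆), ← lie_skew z x, tmul_neg,
      map_neg] at h
    simp only [formComponent_apply]
    linear_combination h
  choose φ hφ using fun n : ℤ => exists_eq_apply_lie _ (hcoc (A S e₁ e₂ n))
  -- As `1 = A 0`, the 1-cocycle for `A n` vanishes for `n < K`, and `g` is spanned by brackets.
  have hφ0 (n : ℤ) (hn : n < K) : φ n = 0 := by
    refine linearMap_ext_of_lie fun x y => ?_
    rw [← hφ, formComponent_apply, ← A_zero, hK 0 n (by omega), LinearMap.zero_apply]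
  -- Subtracting the coboundary of `Φ` makes the cocycle vanish on `1 ⊗ g`.
  let Φ : CurrentAlgebra S e₁ e₂ g →ₗ[S] S := ofComponents φ
  have hΦ (n : ℤ) (x : g) : Φ (tmul (A S e₁ e₂ n) x) = φ n x := ofComponents_tmul φ n x
  obtain ⟨ψ', hψ'⟩ : ∃ ψ' : LinearMap.BilinForm S (CurrentAlgebra S e₁ e₂ g),
      ∀ u v, ψ' u v = ψ u v - Φ ⁅u, v⁆ :=
    ⟨LinearMap.mk₂ S (fun u v => ψ u v - Φ ⁅u, v⁆)
      (fun u u' v => by simp only [map_add, add_lie, LinearMap.add_apply]; ring)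
      (fun c u v => by simp only [map_smul, smul_lie, LinearMap.smul_apply, smul_sub])
      (fun u v v' => by simp only [map_add, lie_add]; ring)
      (fun c u v => by simp only [map_smul, lie_smul, smul_sub]), fun _ _ => rfl⟩
  refine ⟨_, ψ', hψ.sub_coboundary Φ hψ', fun n m hnm x y => ?_, fun x f y => ?_⟩
  · have h : ⁅tmul (A S e₁ e₂ n) x, tmul (A S e₁ e₂ m) y⁆ ∈ LinearMap.ker Φ := by
      refine lie_mem_of_homogeneousPart _ (fun k _ hk => ?_) (tmul_mem_homogeneousPart n x)
        (tmul_mem_homogeneousPart m y)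
      refine Submodule.span_le.mpr ?_
      rintro _ ⟨z, rfl⟩
      rw [SetLike.mem_coe, LinearMap.mem_ker, hΦ, hφ0 k (by omega), LinearMap.zero_apply]
    rw [hψ', hK n m hnm, LinearMap.mem_ker.mp h, sub_zero]
  · induction f using A_induction with
    | hA n =>
      rw [hψ', lie_tmul, one_mul, hΦ, ← hφ, formComponent_apply, sub_self]
    | hadd f f' h h' => rw [add_tmul, map_add, h, h', add_zero]
    | hsmul c f h => rw [smul_tmul, map_smul, h, smul_zero]

/-- A normalized cocycle is invariant under `1 ⊗ g`, so that all its components are multiples of the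
Killing form; the multiples form a cyclic form on the function algebra. -/
lemma exists_eq_killingForm_smul_cyclicForm {C : CentralExtension S (CurrentAlgebra S e₁ e₂ g)}
    {σ : CurrentAlgebra S e₁ e₂ g →ₗ[S] C.E}
    {ψ : LinearMap.BilinForm S (CurrentAlgebra S e₁ e₂ g)} (hψ : C.IsSection σ ψ)
    (h1 : ∀ (x : g) (f : FunctionAlgebra S e₁ e₂) (y : g), ψ (tmul 1 x) (tmul f y) = 0) :
    ∃ γ : LinearMap.BilinForm S (FunctionAlgebra S e₁ e₂), IsCyclicForm γ ∧
      ∀ f h (x y : g), ψ (tmul f x) (tmul h y) = killingForm ℂ g x y • γ f h := by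
  have hinv (f h : FunctionAlgebra S e₁ e₂) (x y z : g) :
      formComponent ψ f h ⁅x, y⁆ z = formComponent ψ f h x ⁅y, z⁆ := by
    have hc := hψ.cocycle (tmul f x) (tmul 1 y) (tmul h z)
    simp only [lie_tmul, one_mul, mul_one] at hc
    rw [hψ.skew (tmul h ⁅y, z⁆), hψ.skew (tmul (h * f) _), h1] at hc
    simp only [formComponent_apply]
    linear_combination hc
  choose m hm using fun f h => exists_eq_killingForm_smul (formComponent ψ f h) (hinv f h)
  obtain ⟨x₀, hx₀⟩ := exists_killingForm_self_ne_zero g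
  set k := killingForm ℂ g x₀ x₀ with hk
  let γ : LinearMap.BilinForm S (FunctionAlgebra S e₁ e₂) :=
    LinearMap.mk₂ S (fun f h => k⁻¹ • ψ (tmul f x₀) (tmul h x₀))
      (fun _ _ _ => by simp only [add_tmul, map_add, LinearMap.add_apply, smul_add])
      (fun _ _ _ => by
        simp only [smul_tmul, map_smul, LinearMap.smul_apply, smul_eq_mul, mul_smul_comm])
      (fun _ _ _ => by simp only [add_tmul, map_add, smul_add])
      (fun _ _ _ => by simp only [smul_tmul, map_smul, smul_eq_mul, mul_smul_comm])
  have hγ (f h : FunctionAlgebra S e₁ e₂) : γ f h = k⁻¹ • ψ (tmul f x₀) (tmul h x₀) := rfl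
  have hψγ (f h : FunctionAlgebra S e₁ e₂) (x y : g) :
      ψ (tmul f x) (tmul h y) = killingForm ℂ g x y • γ f h := by
    rw [hγ, ← formComponent_apply, ← formComponent_apply, hm, hm, ← hk, inv_smul_smul₀ hx₀]
  refine ⟨γ, ⟨fun f h => ?_, fun f₁ f₂ f₃ => ?_⟩, hψγ⟩
  · rw [hγ, hγ, hψ.skew, smul_neg]
  · obtain ⟨x, y, z, hxyz⟩ := exists_killingForm_lie_ne_zero g
    have hκ : ∀ x y z, killingForm ℂ g ⁅x, y⁆ z = killingForm ℂ g x ⁅y, z⁆ :=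
      LieModule.traceForm_apply_lie_apply ℂ g g
    have hκs : ∀ x y, killingForm ℂ g x y = killingForm ℂ g y x :=
      LieModule.traceForm_comm ℂ g g
    have hc := hψ.cocycle (tmul f₁ x) (tmul f₂ y) (tmul f₃ z)
    rw [lie_tmul, lie_tmul, lie_tmul, hψγ, hψγ, hψγ, hκs ⁅y, z⁆, ← hκ x, hκ z, hκs z, ← smul_add,
      ← smul_add, smul_eq_zero, or_iff_right hxyz] at hc
    exact hc

/-- Every almost-graded central extension of the current algebra is, up to equivalence, a unique
geometric one. -/
theorem existsUnique_equivalent_killingExtension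
    {C : CentralExtension S (CurrentAlgebra S e₁ e₂ g)}
    (hC : C.IsAlmostGraded (homogeneousPart S e₁ e₂ g)) :
    ∃! p : S, C.Equivalent (killingExtension e₁ e₂ g p) := by
  obtain ⟨σ₀, ψ₀, hψ₀, K, hK₀⟩ := exists_local_isSection hC
  obtain ⟨σ, ψ, hψ, hK, h1⟩ := exists_normalized_isSection hψ₀ hK₀
  obtain ⟨γ, hγ, hψγ⟩ := exists_eq_killingForm_smul_cyclicForm hψ h1
  obtain ⟨x₀, hx₀⟩ := exists_killingForm_self_ne_zero g
  obtain ⟨p, rfl⟩ := hγ.exists_eq_smul_cycleForm ⟨K, fun n m hnm => by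
    have h := hψγ (A S e₁ e₂ n) (A S e₁ e₂ m) x₀ x₀
    rw [hK n m hnm] at h
    exact (smul_eq_zero.mp h.symm).resolve_left hx₀⟩
  have hψp : ψ = affineForm e₁ e₂ (killingForm ℂ g) p := by
    refine LinearMap.ext₂ fun u v => ?_
    induction u using CurrentAlgebra.induction with
    | h f x =>
      induction v using CurrentAlgebra.induction with
      | h h y =>
        rw [hψγ, affineForm_tmul, LinearMap.smul_apply, LinearMap.smul_apply, smul_eq_mul,
          mul_smul_comm]
      | hadd v v' hv hv' => rw [map_add, map_add, hv, hv']
    | hadd u u' hu hu' =>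
      rw [map_add, map_add, LinearMap.add_apply, LinearMap.add_apply, hu, hu']
  subst hψp
  obtain ⟨τ, hτ⟩ := isSection_killingExtension (g := g) (e₁ := e₁) (e₂ := e₂) p
  exact ⟨p, hψ.equivalent hτ, fun p' hp' =>
    killingExtension_param_unique hp' (hψ.equivalent hτ)⟩

end Classification

end EllipticCurrent

end

theorem mainTheorem6 {g : Type u} [LieRing g] [LieAlgebra ℂ g] [FiniteDimensional ℂ g]
    [LieAlgebra.IsSimple ℂ g] :
    -- every symmetric invariant bilinear form is a unique multiple of the Cartan-Killing form
    (∀ β : LinearMap.BilinForm ℂ g, (∀ x y, β x y = β y x) → (∀ x y z, β ⁅x, y⁆ z = β x ⁅y, z⁆) →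
      ∃! c : ℂ, β = c • killingForm ℂ g) ∧
    -- at every point of the base, the cocycle is given by integration over a separating cycle
    (∀ e₁ e₂ : ℂ, ∃ ρ > 0, ∀ r : ℝ, 0 < r → r < ρ → ∀ n m : ℤ,
      EllipticCurrent.separatingIntegral e₁ e₂ r n m = EllipticCurrent.cycleValue e₁ e₂ n m) ∧
    -- the family over `ℂ[e₁, e₂]`: existence and uniqueness
    (∀ p : MvPolynomial (Fin 2) ℂ,
      (EllipticCurrent.killingExtension (MvPolynomial.X 0) (MvPolynomial.X 1) g p).IsAlmostGraded
        (EllipticCurrent.homogeneousPart (MvPolynomial (Fin 2) ℂ)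
          (MvPolynomial.X 0) (MvPolynomial.X 1) g)) ∧
    (∀ C : EllipticCurrent.CentralExtension.{0, u, v} (MvPolynomial (Fin 2) ℂ)
        (EllipticCurrent.CurrentAlgebra (MvPolynomial (Fin 2) ℂ)
          (MvPolynomial.X 0) (MvPolynomial.X 1) g),
      C.IsAlmostGraded (EllipticCurrent.homogeneousPart (MvPolynomial (Fin 2) ℂ)
        (MvPolynomial.X 0) (MvPolynomial.X 1) g) →
      ∃! p : MvPolynomial (Fin 2) ℂ, C.Equivalent
        (EllipticCurrent.killingExtension (MvPolynomial.X 0) (MvPolynomial.X 1) g p)) ∧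
    -- the individual algebras of the family: existence and uniqueness
    (∀ e₁ e₂ : ℂ,
      (∀ c : ℂ, (EllipticCurrent.killingExtension e₁ e₂ g c).IsAlmostGraded
        (EllipticCurrent.homogeneousPart ℂ e₁ e₂ g)) ∧
      ∀ C : EllipticCurrent.CentralExtension.{0, u, v} ℂ
          (EllipticCurrent.CurrentAlgebra ℂ e₁ e₂ g),
        C.IsAlmostGraded (EllipticCurrent.homogeneousPart ℂ e₁ e₂ g) →
        ∃! c : ℂ, C.Equivalent (EllipticCurrent.killingExtension e₁ e₂ g c)) := by
  refine ⟨fun β _ hinv => ?_, EllipticCurrent.exists_separatingIntegral_eq_cycleValue,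
    fun p => EllipticCurrent.killingExtension_isAlmostGraded p,
    fun C hC => EllipticCurrent.existsUnique_equivalent_killingExtension hC,
    fun e₁ e₂ => ⟨fun c => EllipticCurrent.killingExtension_isAlmostGraded c,
      fun C hC => EllipticCurrent.existsUnique_equivalent_killingExtension hC⟩⟩
  obtain ⟨c, rfl⟩ := EllipticCurrent.exists_eq_smul_killingForm β hinv
  obtain ⟨x, hx⟩ := EllipticCurrent.exists_killingForm_self_ne_zero g
  refine ⟨c, rfl, fun c' hc' => ?_⟩
  have h : c * killingForm ℂ g x x = c' * killingForm ℂ g x x := congr($hc' x x)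
  exact (mul_right_cancel₀ hx h).symm
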